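/- Let $H, H_1,\dots,H_m$ ($m\ge 0$) be Euclidean spaces (finite-dimensional real Hilbert spaces with Lebesgue measure), let $B_j:H\to H_j$ be linear maps, and let $p_j>0$ for $1\le j\le m$. Write $(\mathbf B,\mathbf p)$ for this Brascamp--Lieb datum. Set $$\mathrm{BL}(\mathbf B,\mathbf p)=\sup_{\mathbf f}\frac{\int_H\prod_j (f_j\circ B_j)^{p_j}}{\prod_j\left(\int_{H_j}f_j\right)^{p_j}}\in(0,\infty],$$ the supremum being over all measurable $f_j:H_j\to[0,\infty)$ with $0<\int_{H_j} f_j<\infty$. A gaussian input is a tuple $\mathbf A=(A_j)_{1\le j\le m}$ of positive definite (in particular self-adjoint) transformations $A_j:H_j\to H_j$. For such $\mathbf A$ set $$\mathrm{BL}_{\mathbf g}(\mathbf B,\mathbf p;\mathbf A)=\left(\frac{\prod_j(\det A_j)^{p_j}}{\det\left(\sum_j p_jB_j^*A_jB_j\right)}\right)^{1/2}\in(0,\infty]$$ (equal to $+\infty$ if the denominator vanishes), and $\mathrm{BL}_{\mathbf g}(\mathbf B,\mathbf p)=\sup_{\mathbf A}\mathrm{BL}_{\mathbf g}(\mathbf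 B,\mathbf p;\mathbf A)$. Call $(\mathbf B,\mathbf p)$ gaussian-extremisable if this supremum is finite and attained. Call $\mathbf B$ non-degenerate if all $B_j$ are surjective and $\bigcap_j\ker B_j=\{0\}$; the scaling condition is $\dim H=\sum_j p_j\dim H_j$. The datum is geometric if $B_jB_j^*=\mathrm{id}_{H_j}$ for all $j$ and $\sum_j p_jB_j^*B_j=\mathrm{id}_H$. It is equivalent to a datum $(\mathbf B',\mathbf p')$ (with spaces $H',H_j'$) with intertwining transformations $C:H'\to H$, $C_j:H'_j\to H_j$ if $C, C_j$ are invertible linear maps, $B'_j=C_j^{-1}B_jC$ for all $j$, and $\mathbf p'=\mathbf p$. For self-adjoint $S,T$, $S\le T$ means that $T-S$ is positive semi-definite. **Proposition.** Let $\mathbf A$ be a gaussian input for $(\mathbf B,\mathbf p)$ and $M:=\sum_{j=1}^m p_jB_j^*A_jB_j$. The following seven statements are equivalent. (a) $\mathbf A$ is a global extremiser: $\mathrm{BL}_{\mathbf g}(\mathbf B,\mathbf p;\mathbf A)$ is finite and $\mathrm{BL}_{\mathbf g}(\mathbf B,\mathbf p;\mathbf A')\le \mathrm{BL}_{\mathbf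 g}(\mathbf B,\mathbf p;\mathbf A)$ for all gaussian inputs $\mathbf A'$. (b) $\mathbf A$ is a local extremiser: $\mathrm{BL}_{\mathbf g}(\mathbf B,\mathbf p;\mathbf A)$ is finite and $\mathrm{BL}_{\mathbf g}(\mathbf B,\mathbf p;\mathbf A')\le \mathrm{BL}_{\mathbf g}(\mathbf B,\mathbf p;\mathbf A)$ for all gaussian inputs $\mathbf A'$ in some neighbourhood of $\mathbf A$. (c) $M$ is invertible and $A_j^{-1}-B_jM^{-1}B_j^*=0$ for all $j$. (d) The scaling condition holds, $\mathbf B$ is non-degenerate (so that $M$ is invertible), and $A_j^{-1}\ge B_jM^{-1}B_j^*$ for all $j$. (e) The scaling condition holds, $\mathbf B$ is non-degenerate, and $B_j^*A_jB_j\le M$ for all $j$. (f) $M$ is invertible, and $(\mathbf B,\mathbf p)$ is equivalent to a geometric datum $(\mathbf B',\mathbf p')$ (with $H'=H$, $H'_j=H_j$) with intertwining transformations $C=M^{-1/2}$ and $C_j=A_j^{-1/2}$, and $$\mathrm{BL}(\mathbf B,\mathbf p)=\mathrm{BL}(\mathbf B',\mathbf p')\,\mathrm{BL}_{\mathbf g}(\mathbf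 B,\mathbf p;\mathbf A),\qquad \mathrm{BL}_{\mathbf g}(\mathbf B,\mathbf p)=\mathrm{BL}_{\mathbf g}(\mathbf B',\mathbf p')\,\mathrm{BL}_{\mathbf g}(\mathbf B,\mathbf p;\mathbf A).$$ (g) $M$ is invertible, and $(\mathbf B,\mathbf p)$ is equivalent to a geometric datum $(\mathbf B',\mathbf p')$ (with $H'=H$, $H'_j=H_j$) with intertwining transformations $C=M^{-1/2}$ and $C_j=A_j^{-1/2}$, with $H_j$ equal to the range of $C_j$, and $$\mathrm{BL}(\mathbf B,\mathbf p)=\mathrm{BL}_{\mathbf g}(\mathbf B,\mathbf p)=\mathrm{BL}_{\mathbf g}(\mathbf B,\mathbf p;\mathbf A).$$ In particular, if (a) holds, then $\mathrm{BL}_{\mathbf g}(\mathbf B,\mathbf p)=\mathrm{BL}_{\mathbf g}(\mathbf B,\mathbf p;\mathbf A)$ is finite and $(\mathbf B,\mathbf p)$ is gaussian-extremisable. -/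

import Mathlib

open MeasureTheory Set
open scoped ENNReal NNReal

/-- A Brascamp--Lieb datum with domain the Euclidean space `H` and targets the Euclidean spaces
`K j`, `j < m`: linear maps `B j : H → K j` (on finite-dimensional spaces every linear map is
continuous) together with nonnegative exponents `p j`. -/
structure BLDatum {m : ℕ} (H : Type*) [NormedAddCommGroup H] [InnerProductSpace ℝ H]
    (K : Fin m → Type*) [∀ j, NormedAddCommGroup (K j)] [∀ j, InnerProductSpace ℝ (K j)] where
  B : ∀ j, H →L[ℝ] K j
  p : Fin m → ℝ
  p_nonneg : ∀ j, 0 ≤ p j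

/-- Positive definite transformation: self-adjoint with positive definite quadratic form. -/
def IsPosDefOp {E : Type*} [NormedAddCommGroup E] [InnerProductSpace ℝ E] [FiniteDimensional ℝ E]
    (T : E →L[ℝ] E) : Prop :=
  IsSelfAdjoint T ∧ ∀ x : E, x ≠ 0 → 0 < inner ℝ (T x) x

/-- `C = T ^ (-1/2)`: `T` is invertible and `C` is the (unique) positive definite square root
of `T⁻¹`. -/
def IsInvSqrt {E : Type*} [NormedAddCommGroup E] [InnerProductSpace ℝ E] [FiniteDimensional ℝ E]
    (C T : E →L[ℝ] E) : Prop :=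
  IsUnit T ∧ IsPosDefOp C ∧ C ∘L C = Ring.inverse T

namespace BLDatum

section Algebra

variable {m : ℕ} {H : Type*} [NormedAddCommGroup H] [InnerProductSpace ℝ H]
  [FiniteDimensional ℝ H] {K : Fin m → Type*} [∀ j, NormedAddCommGroup (K j)]
  [∀ j, InnerProductSpace ℝ (K j)] [∀ j, FiniteDimensional ℝ (K j)]

/-- All `B j` are surjective and their common kernel is trivial. -/
def NonDegenerate (D : BLDatum H K) : Prop :=
  (∀ j, Function.Surjective (D.B j)) ∧ ∀ x : H, (∀ j, D.B j x = 0) → x = 0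

/-- The scaling condition `dim H = ∑ j, p j * dim (K j)`. -/
def Scaling (D : BLDatum H K) : Prop :=
  (Module.finrank ℝ H : ℝ) = ∑ j, D.p j * (Module.finrank ℝ (K j) : ℝ)

/-- Geometric data: `B j (B j)* = id` for all `j`, and `∑ j, p j (B j)* B j = id`. -/
def Geometric (D : BLDatum H K) : Prop :=
  (∀ j, D.B j ∘L ContinuousLinearMap.adjoint (D.B j) = ContinuousLinearMap.id ℝ (K j)) ∧
    ∑ j, D.p j • (ContinuousLinearMap.adjoint (D.B j) ∘L D.B j) = ContinuousLinearMap.id ℝ H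

/-- A gaussian input: a tuple of positive definite transformations `A j` of `K j`. -/
def IsGaussianInput (A : ∀ j, K j →L[ℝ] K j) : Prop :=
  ∀ j, IsPosDefOp (A j)

/-- `M = ∑ j, p j (B j)* (A j) (B j)`. -/
noncomputable def opM (D : BLDatum H K) (A : ∀ j, K j →L[ℝ] K j) : H →L[ℝ] H :=
  ∑ j, D.p j • (ContinuousLinearMap.adjoint (D.B j) ∘L A j ∘L D.B j)

/-- `BL_g(B, p; A) = (∏ j, det (A j) ^ p j / det M) ^ (1/2)` for a gaussian input `A`; the
value is `∞` when `det M = 0`. -/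
noncomputable def gaussBLAt (D : BLDatum H K) (A : ∀ j, K j →L[ℝ] K j) : ℝ≥0∞ :=
  ((∏ j, ENNReal.ofReal (A j).det ^ D.p j) / ENNReal.ofReal (D.opM A).det) ^ (1 / 2 : ℝ)

/-- `BL_g(B, p)`: the supremum over all gaussian inputs. -/
noncomputable def gaussBL (D : BLDatum H K) : ℝ≥0∞ :=
  ⨆ (A : ∀ j, K j →L[ℝ] K j) (_ : IsGaussianInput A), D.gaussBLAt A

/-- There is a gaussian input that attains a finite `BL_g(B, p)`. -/
def GaussianExtremisable (D : BLDatum H K) : Prop :=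
  D.gaussBL < ∞ ∧ ∃ A : ∀ j, K j →L[ℝ] K j, IsGaussianInput A ∧ D.gaussBL = D.gaussBLAt A

/-- `A` maximises `BL_g(B, p; ·)` over all gaussian inputs, with a finite value. -/
def IsGlobalExtremiser (D : BLDatum H K) (A : ∀ j, K j →L[ℝ] K j) : Prop :=
  IsGaussianInput A ∧ D.gaussBLAt A < ∞ ∧
    ∀ A' : ∀ j, K j →L[ℝ] K j, IsGaussianInput A' → D.gaussBLAt A' ≤ D.gaussBLAt A

/-- `A` maximises `BL_g(B, p; ·)` over all gaussian inputs in a neighbourhood of `A`, with a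
finite value. -/
def IsLocalExtremiser (D : BLDatum H K) (A : ∀ j, K j →L[ℝ] K j) : Prop :=
  IsGaussianInput A ∧ D.gaussBLAt A < ∞ ∧
    IsLocalMaxOn D.gaussBLAt {A' : ∀ j, K j →L[ℝ] K j | IsGaussianInput A'} A

end Algebra

/-- `D` is equivalent to `D'` with intertwining transformations `C : H' → H` and
`Cj j : K' j → K j`: the exponents agree and `B' j = (Cj j)⁻¹ (B j) C`. -/
def EquivalentVia {m : ℕ} {H H' : Type*} [NormedAddCommGroup H] [InnerProductSpace ℝ H]
    [NormedAddCommGroup H'] [InnerProductSpace ℝ H'] {K K' : Fin m → Type*}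
    [∀ j, NormedAddCommGroup (K j)] [∀ j, InnerProductSpace ℝ (K j)]
    [∀ j, NormedAddCommGroup (K' j)] [∀ j, InnerProductSpace ℝ (K' j)]
    (D : BLDatum H K) (D' : BLDatum H' K') (C : H' ≃L[ℝ] H) (Cj : ∀ j, K' j ≃L[ℝ] K j) : Prop :=
  D'.p = D.p ∧
    ∀ j, D'.B j = ((Cj j).symm : K j →L[ℝ] K' j) ∘L D.B j ∘L (C : H' →L[ℝ] H)

section Measure

variable {m : ℕ} {H : Type*} [NormedAddCommGroup H] [InnerProductSpace ℝ H]
  [FiniteDimensional ℝ H] [MeasurableSpace H] [BorelSpace H] {K : Fin m → Type*}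
  [∀ j, NormedAddCommGroup (K j)] [∀ j, InnerProductSpace ℝ (K j)]
  [∀ j, FiniteDimensional ℝ (K j)] [∀ j, MeasurableSpace (K j)] [∀ j, BorelSpace (K j)]

/-- An input: nonnegative measurable functions with positive finite integrals. -/
def IsInput (f : ∀ j, K j → ℝ≥0) : Prop :=
  ∀ j, Measurable (f j) ∧ 0 < ∫⁻ y, (f j y : ℝ≥0∞) ∧ ∫⁻ y, (f j y : ℝ≥0∞) < ∞

/-- `BL(B, p; f) = ∫ ∏ j, (f j ∘ B j) ^ p j / ∏ j, (∫ f j) ^ p j`, integrals being with respect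
to Lebesgue measure. -/
noncomputable def blAt (D : BLDatum H K) (f : ∀ j, K j → ℝ≥0) : ℝ≥0∞ :=
  (∫⁻ x : H, ∏ j, (f j (D.B j x) : ℝ≥0∞) ^ D.p j) / ∏ j, (∫⁻ y, (f j y : ℝ≥0∞)) ^ D.p j

/-- The Brascamp--Lieb constant `BL(B, p)`: the supremum over all inputs. -/
noncomputable def bl (D : BLDatum H K) : ℝ≥0∞ :=
  ⨆ (f : ∀ j, K j → ℝ≥0) (_ : IsInput f), D.blAt f

end Measure

end BLDatum

/-! Everything passes through the Euler–Lagrange equation (c), and (c) says that a conjugated datum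
is geometric. With `C = M^(-1/2)` and `Cj = A_j^(-1/2)`, the datum `B'_j = Cj⁻¹ B_j C` always
satisfies `∑ p_j B'_j* B'_j = id`, and `B'_j B'_j* = id` is exactly (c) (`geometric_conj_iff`).
Conditions (d) and (e) say that `B'_j*`, respectively `B'_j`, is a contraction; these agree because
an operator and its adjoint have the same norm. The scaling condition makes the `p_j`-weighted
traces of the positive operators `id - B'_j B'_j*` sum to zero, so each of them vanishes
(`comp_adjoint_eq_id_of_norm_le`).

For (b) ⇒ (c), perturb `A_j` in the direction of its own defect `S = A_j⁻¹ - B_j M⁻¹ B_j*`. The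
first variation of the log of the quotient inside the square root is `p_j tr(S²)`, which must be
zero at a local maximum, so `S = 0` (`IsLocalExtremiser.euler_lagrange`).

For (c) ⇒ (a), (f), (g), the analytic input is that a geometric datum has Brascamp–Lieb constant at
most one (`Geometric.lintegral_prod_le`). A linear change of variables turns this into `BL ≤
BL_g(A)`; testing on gaussians gives `BL_g ≤ BL`, and all constants coincide
(`bl_eq_gaussBL_eq_gaussBLAt`).

The geometric inequality is proved by a discrete heat flow. Dividing each `f_j` by the gaussian
density turns it into `∫ ∏ F_j(B_j x)^p_j dγ ≤ ∏ (∫ F_j dγ)^p_j` for standard gaussian measures. For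
smooth `g_j` bounded above and away from zero, one gaussian average of size `τ` satisfies `G_τ(∏
g_j^p_j) ≤ (1 + C τ³) ∏ (G_τ g_j)^p_j`: the first-order fluctuations have mean zero, and the
second-order term is half of `τ² (|∑ p_j v_j|² - ∑ p_j |v_j|²)`, where `v_j` is a normalised
gradient in the range of `B_j*`. Geometricity makes this nonpositive. Since variances add, `n` steps
with `τ = n^(-1/2)` amount to one standard gaussian average, and the accumulated error `(1 + C
n^(-3/2))^n` tends to one. Smooth approximation and Fatou remove the regularity. -/

open ProbabilityTheory Filter Topology

/-! ### Second-order expansion of products of powers, with uniform cubic error. -/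

section Taylor

/-- The difference of the two sides has derivative `x³ / (1 + x)`, which has the sign of `x`, so its
minimum is at zero. -/
theorem log_one_add_le_cubic {w : ℝ} (hw : -1 < w) :
    Real.log (1 + w) ≤ w - w ^ 2 / 2 + w ^ 3 / 3 := by
  set f : ℝ → ℝ := fun w => w - w ^ 2 / 2 + w ^ 3 / 3 - Real.log (1 + w) with hf
  have hd : ∀ x : ℝ, -1 < x → HasDerivAt f (x ^ 3 / (1 + x)) x := by
    intro x hx
    have h1 : (1 + x) ≠ 0 := by linarith
    have h2 := (((hasDerivAt_id x).sub (((hasDerivAt_id x).pow 2).div_const 2)).add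
      (((hasDerivAt_id x).pow 3).div_const 3)).sub (((hasDerivAt_id x).const_add 1).log h1)
    convert! h2 using 1
    simp only [id]
    field_simp
    ring
  have f0 : f 0 = 0 := by simp [hf]
  have key : 0 ≤ f w := by
    rcases le_total 0 w with h | h
    · rw [← f0]
      refine monotoneOn_of_deriv_nonneg (convex_Icc 0 w) ?_ ?_ ?_ (left_mem_Icc.2 h)
        (right_mem_Icc.2 h) h
      · exact fun x hx => (hd x (by linarith [hx.1])).continuousAt.continuousWithinAt
      · intro x hx
        rw [interior_Icc] at hx
        exact (hd x (by linarith [hx.1])).differentiableAt.differentiableWithinAt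
      · intro x hx
        rw [interior_Icc] at hx
        have := hx.1
        rw [(hd x (by linarith [hx.1])).deriv]
        positivity
    · rw [← f0]
      refine antitoneOn_of_deriv_nonpos (convex_Icc w 0) ?_ ?_ ?_ (left_mem_Icc.2 h)
        (right_mem_Icc.2 h) h
      · exact fun x hx => (hd x (by linarith [hx.1])).continuousAt.continuousWithinAt
      · intro x hx
        rw [interior_Icc] at hx
        exact (hd x (by linarith [hx.1])).differentiableAt.differentiableWithinAt
      · intro x hx
        rw [interior_Icc] at hx
        rw [(hd x (by linarith [hx.1])).deriv]
        exact div_nonpos_of_nonpos_of_nonneg (Odd.pow_nonpos (by decide) hx.2.le)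
          (by linarith [hx.1])
  simp only [hf] at key
  linarith

theorem exp_le_quadratic_add (s : ℝ) :
    Real.exp s ≤ 1 + s + s ^ 2 / 2 + |s| ^ 3 * Real.exp |s| := by
  have h := Complex.norm_exp_sub_sum_le_norm_mul_exp (s : ℂ) 3
  have h2 : (Complex.exp s - ∑ m ∈ Finset.range 3, (s : ℂ) ^ m / (m.factorial : ℂ))
      = ((Real.exp s - (1 + s + s ^ 2 / 2) : ℝ) : ℂ) := by
    simp [Finset.sum_range_succ, Nat.factorial]
  rw [h2, Complex.norm_real, Complex.norm_real, Real.norm_eq_abs, Real.norm_eq_abs] at h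
  linarith [le_abs_self (Real.exp s - (1 + s + s ^ 2 / 2))]

variable {ι : Type*} [Fintype ι]

theorem abs_sum_mul_le {p : ι → ℝ} (hp : ∀ j, 0 ≤ p j) {w : ι → ℝ} {r : ℝ}
    (h : ∀ j, |w j| ≤ r) : |∑ j, p j * w j| ≤ (∑ j, p j) * r := by
  refine (Finset.abs_sum_le_sum_abs _ _).trans ?_
  rw [Finset.sum_mul]
  refine Finset.sum_le_sum fun j _ => ?_
  rw [abs_mul, abs_of_nonneg (hp j)]
  exact mul_le_mul_of_nonneg_left (h j) (hp j)

/-- Bound the logarithm of the product by its cubic Taylor polynomial and exponentiate. The constant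
depends only on `p` and `W`, so it can later be used at all points and for all functions at once. -/
theorem prod_one_add_rpow_le {p : ι → ℝ} (hp : ∀ j, 0 ≤ p j) {W : ℝ} (hW : 0 ≤ W) :
    ∃ C : ℝ, 0 ≤ C ∧ ∀ (w : ι → ℝ) (r : ℝ), 0 ≤ r → (∀ j, -1 < w j) → (∀ j, |w j| ≤ W) →
      (∀ j, |w j| ≤ r) → ∏ j, (1 + w j) ^ p j ≤
        1 + ∑ j, p j * w j + ((∑ j, p j * w j) ^ 2 - ∑ j, p j * w j ^ 2) / 2 + C * r ^ 3 := by
  set P : ℝ := ∑ j, p j with hP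
  have hP0 : 0 ≤ P := Finset.sum_nonneg fun j _ => hp j
  set K : ℝ := P * (1 + W / 2 + W ^ 2 / 3) with hK
  have hK0 : 0 ≤ K := by positivity
  -- The three summands absorb the cubic term of the logarithm, the replacement of `s²` by `s1²` in
  -- the exponential, and the remainder of the exponential.
  set C : ℝ := P / 3 + P * (1 / 2 + W / 3) * (K + P) / 2 + K ^ 3 * Real.exp (K * W) with hC
  have hC0 : 0 ≤ C := by positivity
  refine ⟨C, hC0, fun w r₀ hr₀ h1 hwW hwr₀ => ?_⟩
  -- Capping `r` at `W` allows surplus powers of `r` to be absorbed into the constants.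
  obtain ⟨r, hr0, hrr₀, hrW, hwr⟩ : ∃ r, 0 ≤ r ∧ r ≤ r₀ ∧ r ≤ W ∧ ∀ j, |w j| ≤ r :=
    ⟨min r₀ W, le_min hr₀ hW, min_le_left _ _, min_le_right _ _,
      fun j => le_min (hwr₀ j) (hwW j)⟩
  suffices h : ∏ j, (1 + w j) ^ p j ≤
      1 + ∑ j, p j * w j + ((∑ j, p j * w j) ^ 2 - ∑ j, p j * w j ^ 2) / 2 + C * r ^ 3 by
    refine h.trans ?_
    gcongr
  set s1 : ℝ := ∑ j, p j * w j with hs1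
  set s2 : ℝ := ∑ j, p j * w j ^ 2 with hs2
  set s3 : ℝ := ∑ j, p j * w j ^ 3 with hs3
  have b1 : |s1| ≤ P * r := abs_sum_mul_le hp hwr
  have b2 : |s2| ≤ P * r ^ 2 := abs_sum_mul_le hp fun j => by
    rw [abs_pow]; exact pow_le_pow_left₀ (abs_nonneg _) (hwr j) 2
  have b3 : |s3| ≤ P * r ^ 3 := abs_sum_mul_le hp fun j => by
    rw [abs_pow]; exact pow_le_pow_left₀ (abs_nonneg _) (hwr j) 3
  set s : ℝ := s1 - s2 / 2 + s3 / 3 with hs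
  have hprod : ∏ j, (1 + w j) ^ p j ≤ Real.exp s := by
    have : ∏ j, (1 + w j) ^ p j = Real.exp (∑ j, p j * Real.log (1 + w j)) := by
      rw [Real.exp_sum]
      refine Finset.prod_congr rfl fun j _ => ?_
      rw [Real.rpow_def_of_pos (by linarith [h1 j]), mul_comm]
    rw [this]
    refine Real.exp_le_exp.2 ?_
    have : s = ∑ j, p j * (w j - w j ^ 2 / 2 + w j ^ 3 / 3) := by
      simp only [hs, hs1, hs2, hs3, Finset.sum_div, ← Finset.sum_sub_distrib,
        ← Finset.sum_add_distrib]
      exact Finset.sum_congr rfl fun j _ => by ring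
    rw [this]
    exact Finset.sum_le_sum fun j _ =>
      mul_le_mul_of_nonneg_left (log_one_add_le_cubic (h1 j)) (hp j)
  have hr3 : P * r ^ 3 ≤ P * (r ^ 2 * W) := by
    have : r ^ 3 = r ^ 2 * r := by ring
    rw [this]; gcongr
  have hr2 : P * r ^ 2 ≤ P * (r * W) := by
    have : r ^ 2 = r * r := by ring
    rw [this]; gcongr
  have hr3' : P * r ^ 3 ≤ P * (r * W ^ 2) := by
    have : r ^ 3 = r * r ^ 2 := by ring
    rw [this]; gcongr
  have hd : |s - s1| ≤ P * (1 / 2 + W / 3) * r ^ 2 := by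
    have : s - s1 = -s2 / 2 + s3 / 3 := by rw [hs]; ring
    have e : P * (1 / 2 + W / 3) * r ^ 2 = P * r ^ 2 / 2 + P * (r ^ 2 * W) / 3 := by ring
    rw [this, e, abs_le]
    rw [abs_le] at b2 b3
    constructor <;> linarith
  have hsK : |s| ≤ K * r := by
    have e : K * r = P * r + P * (r * W) / 2 + P * (r * W ^ 2) / 3 := by rw [hK]; ring
    rw [hs, e, abs_le]
    rw [abs_le] at b1 b2 b3
    constructor <;> linarith
  have hsum : |s + s1| ≤ (K + P) * r := by
    refine (abs_add_le _ _).trans ?_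
    linarith
  have hsq : s ^ 2 ≤ s1 ^ 2 + P * (1 / 2 + W / 3) * (K + P) * r ^ 3 := by
    have h3 : (s - s1) * (s + s1) ≤ (P * (1 / 2 + W / 3) * r ^ 2) * ((K + P) * r) := by
      refine (le_abs_self _).trans ?_
      rw [abs_mul]
      exact mul_le_mul hd hsum (abs_nonneg _) (by positivity)
    have e1 : (s - s1) * (s + s1) = s ^ 2 - s1 ^ 2 := by ring
    have e2 : (P * (1 / 2 + W / 3) * r ^ 2) * ((K + P) * r) =
      P * (1 / 2 + W / 3) * (K + P) * r ^ 3 := by ring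
    linarith
  have hcub : |s| ^ 3 * Real.exp |s| ≤ (K * r) ^ 3 * Real.exp (K * W) := by
    have : |s| ≤ K * W := hsK.trans (by gcongr)
    gcongr
  have hfin := exp_le_quadratic_add s
  have b3' := le_of_abs_le b3
  have hCr : C * r ^ 3 = P * r ^ 3 / 3 + P * (1 / 2 + W / 3) * (K + P) * r ^ 3 / 2 +
    (K * r) ^ 3 * Real.exp (K * W) := by rw [hC]; ring
  rw [hCr]
  have : s = s1 - s2 / 2 + s3 / 3 := hs
  linarith

/-- Differences of squares factor as (difference) × (sum), of size `δ * r`. This replaces a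
fluctuation of order `τ` by its linearisation, at distance `τ²`, for a cubic cost. -/
theorem quadratic_form_compare {p : ι → ℝ} (hp : ∀ j, 0 ≤ p j) {w u : ι → ℝ} {r δ : ℝ}
    (hw : ∀ j, |w j| ≤ r) (hu : ∀ j, |u j| ≤ r) (hδ : ∀ j, |w j - u j| ≤ δ)
    (hδ0 : 0 ≤ δ) :
    (∑ j, p j * w j) ^ 2 - ∑ j, p j * w j ^ 2 ≤
      ((∑ j, p j * u j) ^ 2 - ∑ j, p j * u j ^ 2) +
        2 * ((∑ j, p j) ^ 2 + ∑ j, p j) * (δ * r) := by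
  set P : ℝ := ∑ j, p j with hP
  have hP0 : 0 ≤ P := Finset.sum_nonneg fun j _ => hp j
  have h1 : |∑ j, p j * w j - ∑ j, p j * u j| ≤ P * δ := by
    rw [← Finset.sum_sub_distrib]
    simp_rw [← mul_sub]
    exact abs_sum_mul_le hp hδ
  have h2 : |∑ j, p j * w j + ∑ j, p j * u j| ≤ P * (2 * r) := by
    rw [← Finset.sum_add_distrib]
    simp_rw [← mul_add]
    refine abs_sum_mul_le hp fun j => (abs_add_le _ _).trans ?_
    linarith [hw j, hu j]
  have h3 : |∑ j, p j * w j ^ 2 - ∑ j, p j * u j ^ 2| ≤ P * (δ * (2 * r)) := by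
    rw [← Finset.sum_sub_distrib]
    simp_rw [← mul_sub]
    refine abs_sum_mul_le hp fun j => ?_
    have : w j ^ 2 - u j ^ 2 = (w j - u j) * (w j + u j) := by ring
    rw [this, abs_mul]
    refine mul_le_mul (hδ j) ((abs_add_le _ _).trans ?_) (abs_nonneg _) hδ0
    linarith [hw j, hu j]
  have h4 : (∑ j, p j * w j - ∑ j, p j * u j) * (∑ j, p j * w j + ∑ j, p j * u j) ≤
      (P * δ) * (P * (2 * r)) := by
    refine (le_abs_self _).trans ?_
    rw [abs_mul]
    exact mul_le_mul h1 h2 (abs_nonneg _) (by positivity)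
  have h5 := le_of_abs_le ((abs_sub_comm _ _).trans_le h3)
  have e1 : (∑ j, p j * w j - ∑ j, p j * u j) * (∑ j, p j * w j + ∑ j, p j * u j) =
    (∑ j, p j * w j) ^ 2 - (∑ j, p j * u j) ^ 2 := by ring
  have e2 : 2 * (P ^ 2 + P) * (δ * r) = (P * δ) * (P * (2 * r)) + P * (δ * (2 * r)) := by ring
  linarith

end Taylor

/-! ### Gaussian averages, their semigroup law, and a class of functions stable under them. -/

section GaussianAverage

variable {H : Type*} [NormedAddCommGroup H] [InnerProductSpace ℝ H] [FiniteDimensional ℝ H]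
  [MeasurableSpace H] [BorelSpace H]

/-- The average of `g` over the gaussian of variance `τ ^ 2` centred at `x`. -/
noncomputable def gaussAvg {E : Type*} [NormedAddCommGroup E] [NormedSpace ℝ E] (τ : ℝ)
    (g : H → E) (x : H) : E :=
  ∫ ξ, g (x + τ • ξ) ∂(stdGaussian H)

theorem integrable_norm_pow_stdGaussian (n : ℕ) :
    Integrable (fun ξ : H => ‖ξ‖ ^ n) (stdGaussian H) := by
  rcases eq_or_ne n 0 with rfl | hn
  · simp
  · exact (IsGaussian.memLp_id (stdGaussian H) n (by simp)).integrable_norm_pow hn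

theorem integrable_one_add_norm_pow_stdGaussian (n : ℕ) :
    Integrable (fun ξ : H => (1 + ‖ξ‖) ^ n) (stdGaussian H) := by
  simp_rw [add_comm (1 : ℝ), add_pow]
  refine integrable_finsetSum _ fun k _ => ?_
  simpa using (integrable_norm_pow_stdGaussian (H := H) k).mul_const _

theorem integral_inner_stdGaussian (v : H) : ∫ ξ, inner ℝ v ξ ∂(stdGaussian H) = 0 := by
  simpa using integral_strongDual_stdGaussian (innerSL ℝ v)

theorem integral_inner_sq_stdGaussian (v : H) :
    ∫ ξ, (inner ℝ v ξ) ^ 2 ∂(stdGaussian H) = ‖v‖ ^ 2 := by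
  have h := variance_dual_stdGaussian (innerSL ℝ v)
  rw [variance_of_integral_eq_zero (by fun_prop) (integral_strongDual_stdGaussian _)] at h
  simpa using h

theorem integrable_inner_stdGaussian (v : H) :
    Integrable (fun ξ => inner ℝ v ξ) (stdGaussian H) :=
  (innerSL ℝ v).integrable_comp IsGaussian.integrable_id

theorem integrable_inner_sq_stdGaussian (v : H) :
    Integrable (fun ξ => (inner ℝ v ξ) ^ 2) (stdGaussian H) :=
  (IsGaussian.memLp_dual (stdGaussian H) (innerSL ℝ v) 2 (by simp)).integrable_sq

/-- Variances of independent centred gaussians add; characteristic functions show it. -/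
theorem map_add_smul_stdGaussian (a b : ℝ) :
    ((stdGaussian H).prod (stdGaussian H)).map (fun z => a • z.1 + b • z.2) =
      (stdGaussian H).map (fun ξ => √(a ^ 2 + b ^ 2) • ξ) := by
  have h : ((stdGaussian H).prod (stdGaussian H)).map (fun z => a • z.1 + b • z.2) =
      (((stdGaussian H).map (fun ξ => a • ξ)).prod ((stdGaussian H).map (fun ξ => b • ξ))).map
        (fun z => z.1 + z.2) := by
    rw [Measure.map_prod_map _ _ (by fun_prop) (by fun_prop), Measure.map_map (by fun_prop)
      (by fun_prop)]
    rfl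
  have : IsProbabilityMeasure ((stdGaussian H).map (fun ξ => a • ξ)) :=
    Measure.isProbabilityMeasure_map (by fun_prop)
  have : IsProbabilityMeasure ((stdGaussian H).map (fun ξ => b • ξ)) :=
    Measure.isProbabilityMeasure_map (by fun_prop)
  apply Measure.ext_of_charFun
  rw [h, charFun_map_add_prod_eq_mul]
  ext t
  rw [Pi.mul_apply, charFun_map_smul, charFun_map_smul, charFun_map_smul]
  simp only [charFun_stdGaussian, ← Complex.exp_add, norm_smul, Real.norm_eq_abs]
  congr 1
  have : ((√(a ^ 2 + b ^ 2) : ℝ) : ℂ) ^ 2 = (a : ℂ) ^ 2 + (b : ℂ) ^ 2 := by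
    rw [← Complex.ofReal_pow, Real.sq_sqrt (by positivity)]
    push_cast; rfl
  simp only [Complex.ofReal_mul, mul_pow, ← Complex.ofReal_pow, sq_abs,
    Real.sq_sqrt (show 0 ≤ a ^ 2 + b ^ 2 by positivity)]
  push_cast
  ring

theorem gaussAvg_gaussAvg {g : H → ℝ} (hg : Continuous g) {L : ℝ} (hL : ∀ x, |g x| ≤ L)
    (a b : ℝ) (x : H) :
    gaussAvg a (gaussAvg b g) x = gaussAvg √(a ^ 2 + b ^ 2) g x := by
  have h1 : Integrable (fun z : H × H => g (x + a • z.1 + b • z.2))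
      ((stdGaussian H).prod (stdGaussian H)) :=
    Integrable.of_bound (by fun_prop) L (.of_forall fun z => hL _)
  unfold gaussAvg
  rw [← integral_prod _ h1]
  have h2 := integral_map (μ := (stdGaussian H).prod (stdGaussian H))
    (φ := fun z => a • z.1 + b • z.2) (f := fun y => g (x + y)) (by fun_prop) (by fun_prop)
  rw [map_add_smul_stdGaussian, integral_map (by fun_prop) (by fun_prop)] at h2
  simp only [add_assoc]
  exact h2.symm

/-- Functions with values in `[c, L]`, having a bounded continuous gradient field `a`, fixed by
`P`, with a uniform second order Taylor estimate. -/
structure SmoothBounded (P : H →L[ℝ] H) (c L : ℝ) (g : H → ℝ) (a : H → H) : Prop where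
  continuous_grad : Continuous a
  fixed : ∀ x, P (a x) = a x
  lower : ∀ x, c ≤ g x
  upper : ∀ x, g x ≤ L
  grad_le : ∀ x, ‖a x‖ ≤ L
  lipschitz : ∀ x h, |g (x + h) - g x| ≤ L * ‖h‖
  taylor : ∀ x h, |g (x + h) - g x - inner ℝ (a x) h| ≤ L * ‖h‖ ^ 2

namespace SmoothBounded

variable {P : H →L[ℝ] H} {c L : ℝ} {g : H → ℝ} {a : H → H}

omit [FiniteDimensional ℝ H] [MeasurableSpace H] [BorelSpace H] in
theorem continuous (hg : SmoothBounded P c L g a) : Continuous g := by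
  have hL : 0 ≤ L := (norm_nonneg _).trans (hg.grad_le 0)
  refine LipschitzWith.continuous (K := ⟨L, hL⟩) (LipschitzWith.of_dist_le_mul fun x y => ?_)
  have := hg.lipschitz y (x - y)
  rw [add_sub_cancel] at this
  rwa [dist_eq_norm, dist_eq_norm]

omit [FiniteDimensional ℝ H] [MeasurableSpace H] [BorelSpace H] in
theorem abs_le (hg : SmoothBounded P c L g a) (hc : 0 ≤ c) (x : H) : |g x| ≤ L := by
  rw [_root_.abs_le]
  constructor <;> linarith [hg.lower x, hg.upper x]

theorem integrable (hg : SmoothBounded P c L g a) (hc : 0 ≤ c) (τ : ℝ) (x : H) :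
    Integrable (fun ξ => g (x + τ • ξ)) (stdGaussian H) := by
  have := hg.continuous
  exact Integrable.of_bound (by fun_prop) L (.of_forall fun z => hg.abs_le hc _)

theorem integrable_grad (hg : SmoothBounded P c L g a) (τ : ℝ) (x : H) :
    Integrable (fun ξ => a (x + τ • ξ)) (stdGaussian H) := by
  have := hg.continuous_grad
  exact Integrable.of_bound (by fun_prop) L (.of_forall fun z => hg.grad_le _)

/-- Every condition is translation invariant and survives averaging, with the same `c` and `L`.
Hence the one-step error constant does not deteriorate under iteration. -/
theorem gaussAvg (hg : SmoothBounded P c L g a) (hc : 0 ≤ c) (τ : ℝ) :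
    SmoothBounded P c L (gaussAvg τ g) (gaussAvg τ a) where
  continuous_grad := by
    have := hg.continuous_grad
    exact continuous_of_dominated (fun x => by fun_prop)
      (fun x => .of_forall fun ξ => hg.grad_le _) (integrable_const L)
      (.of_forall fun ξ => by fun_prop)
  fixed x := by
    rw [_root_.gaussAvg, ← P.integral_comp_comm (hg.integrable_grad τ x)]
    simp_rw [hg.fixed]
  lower x := by
    have := integral_mono (integrable_const c) (hg.integrable hc τ x) fun ξ => hg.lower _
    simpa [_root_.gaussAvg] using this
  upper x := by
    have := integral_mono (hg.integrable hc τ x) (integrable_const L) fun ξ => hg.upper _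
    simpa [_root_.gaussAvg] using this
  grad_le x := by
    have := norm_integral_le_of_norm_le_const (μ := stdGaussian H)
      (.of_forall fun ξ => hg.grad_le (x + τ • ξ))
    simpa [_root_.gaussAvg] using this
  lipschitz x h := by
    unfold _root_.gaussAvg
    rw [← integral_sub (hg.integrable hc τ _) (hg.integrable hc τ _)]
    have := norm_integral_le_of_norm_le_const (μ := stdGaussian H) (C := L * ‖h‖)
      (f := fun ξ => g (x + h + τ • ξ) - g (x + τ • ξ)) (.of_forall fun ξ => by
        have := hg.lipschitz (x + τ • ξ) h
        rwa [add_right_comm] at this)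
    simpa using this
  taylor x h := by
    have e : inner ℝ (_root_.gaussAvg τ a x) h =
        ∫ ξ, inner ℝ (a (x + τ • ξ)) h ∂(stdGaussian H) := by
      simp_rw [real_inner_comm h]
      exact ((innerSL ℝ h).integral_comp_comm (hg.integrable_grad τ x)).symm
    have hi : Integrable (fun ξ => inner ℝ (a (x + τ • ξ)) h) (stdGaussian H) := by
      simp_rw [real_inner_comm h]
      exact (innerSL ℝ h).integrable_comp (hg.integrable_grad τ x)
    rw [e]
    unfold _root_.gaussAvg
    rw [← integral_sub (hg.integrable hc τ _) (hg.integrable hc τ _), ← integral_sub _ hi]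
    · have := norm_integral_le_of_norm_le_const (μ := stdGaussian H) (C := L * ‖h‖ ^ 2)
        (f := fun ξ => g (x + h + τ • ξ) - g (x + τ • ξ) - inner ℝ (a (x + τ • ξ)) h)
        (.of_forall fun ξ => by
          have := hg.taylor (x + τ • ξ) h
          rwa [add_right_comm] at this)
      simpa using this
    · exact (hg.integrable hc τ _).sub (hg.integrable hc τ _)

end SmoothBounded

end GaussianAverage

/-! ### The discrete heat flow inequality. -/

section HeatFlowMonotonicity

variable {H : Type*} [NormedAddCommGroup H] [InnerProductSpace ℝ H] [FiniteDimensional ℝ H]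
  [MeasurableSpace H] [BorelSpace H]

namespace SmoothBounded

variable {P : H →L[ℝ] H} {c L : ℝ} {g : H → ℝ} {a : H → H}

theorem abs_gaussAvg_sub_le (hg : SmoothBounded P c L g a) (hc : 0 ≤ c) {τ : ℝ} (hτ : 0 ≤ τ)
    (x : H) : |_root_.gaussAvg τ g x - g x| ≤ L * τ * ∫ ξ : H, ‖ξ‖ ^ 1 ∂(stdGaussian H) := by
  have e : _root_.gaussAvg τ g x - g x = ∫ ξ, (g (x + τ • ξ) - g x) ∂(stdGaussian H) := by
    rw [integral_sub (hg.integrable hc τ x) (integrable_const _)]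
    simp [_root_.gaussAvg]
  rw [e, ← integral_const_mul, ← Real.norm_eq_abs]
  refine norm_integral_le_of_norm_le ((integrable_norm_pow_stdGaussian (H := H) 1).const_mul _)
    (.of_forall fun ξ => ?_)
  refine (hg.lipschitz x (τ • ξ)).trans_eq ?_
  rw [norm_smul, Real.norm_of_nonneg hτ]; ring

/-- The linear Taylor term averages to zero because the gaussian is centred, which improves the
error from order `τ` to `τ²`. -/
theorem abs_gaussAvg_sub_le_sq (hg : SmoothBounded P c L g a) (hc : 0 ≤ c) (τ : ℝ)
    (x : H) : |_root_.gaussAvg τ g x - g x| ≤ L * τ ^ 2 * ∫ ξ : H, ‖ξ‖ ^ 2 ∂(stdGaussian H) := by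
  have e : _root_.gaussAvg τ g x - g x =
      ∫ ξ, (g (x + τ • ξ) - g x - inner ℝ (a x) (τ • ξ)) ∂(stdGaussian H) := by
    have hi : Integrable (fun ξ => inner ℝ (a x) (τ • ξ)) (stdGaussian H) := by
      simp_rw [real_inner_smul_right]
      exact (integrable_inner_stdGaussian _).const_mul _
    rw [integral_sub _ hi, integral_sub (hg.integrable hc τ x) (integrable_const _)]
    · simp_rw [real_inner_smul_right]
      rw [integral_const_mul, integral_inner_stdGaussian]
      simp [_root_.gaussAvg]
    · exact (hg.integrable hc τ x).sub (integrable_const _)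
  rw [e, ← integral_const_mul, ← Real.norm_eq_abs]
  refine norm_integral_le_of_norm_le ((integrable_norm_pow_stdGaussian (H := H) 2).const_mul _)
    (.of_forall fun ξ => ?_)
  refine (hg.taylor x (τ • ξ)).trans_eq ?_
  rw [norm_smul, mul_pow, Real.norm_eq_abs, sq_abs]; ring

/-- The normalised fluctuation of `g` around its average is, to first order, linear. -/
theorem fluctuation_bounds (hg : SmoothBounded P c L g a) (hc : 0 < c) {D τ : ℝ}
    (hD : D = L / c * (1 + (∫ ξ : H, ‖ξ‖ ^ 1 ∂(stdGaussian H)) +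
      ∫ ξ : H, ‖ξ‖ ^ 2 ∂(stdGaussian H)))
    (hτ : 0 ≤ τ) (x ξ : H) :
    |g (x + τ • ξ) / _root_.gaussAvg τ g x - 1| ≤ D * τ * (1 + ‖ξ‖) ∧
    |τ * inner ℝ ((_root_.gaussAvg τ g x)⁻¹ • a x) ξ| ≤ D * τ * (1 + ‖ξ‖) ∧
    |g (x + τ • ξ) / _root_.gaussAvg τ g x - 1 -
      τ * inner ℝ ((_root_.gaussAvg τ g x)⁻¹ • a x) ξ| ≤ D * τ ^ 2 * (1 + ‖ξ‖) ^ 2 := by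
  have hL : 0 ≤ L := (norm_nonneg _).trans (hg.grad_le 0)
  set E1 : ℝ := ∫ ξ : H, ‖ξ‖ ^ 1 ∂(stdGaussian H) with hE1
  set E2 : ℝ := ∫ ξ : H, ‖ξ‖ ^ 2 ∂(stdGaussian H) with hE2
  have h1 : 0 ≤ E1 := integral_nonneg fun ξ => by positivity
  have h2 : 0 ≤ E2 := integral_nonneg fun ξ => by positivity
  have b1 := hg.abs_gaussAvg_sub_le hc.le hτ x
  have b2 := hg.abs_gaussAvg_sub_le_sq hc.le τ x
  rw [← hE1] at b1
  rw [← hE2] at b2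
  have hG : c ≤ _root_.gaussAvg τ g x := (hg.gaussAvg hc.le τ).lower x
  set G : ℝ := _root_.gaussAvg τ g x with hGdef
  have hG0 : 0 < G := hc.trans_le hG
  have hn := norm_nonneg ξ
  have key : ∀ t B : ℝ, |t| ≤ L * B → |t / G| ≤ L / c * B := by
    intro t B h
    rw [abs_div, abs_of_pos hG0]
    calc |t| / G ≤ |t| / c := by gcongr
      _ ≤ (L * B) / c := by gcongr
      _ = L / c * B := by ring
  have l1 := hg.lipschitz x (τ • ξ)
  have l2 := hg.taylor x (τ • ξ)
  rw [norm_smul, Real.norm_of_nonneg hτ] at l1 l2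
  rw [real_inner_smul_right] at l2
  refine ⟨?_, ?_, ?_⟩
  · have e : g (x + τ • ξ) / G - 1 = (g (x + τ • ξ) - G) / G := by field_simp
    have : |g (x + τ • ξ) - G| ≤ L * (τ * ‖ξ‖ + τ * E1) := by
      have e : g (x + τ • ξ) - G = (g (x + τ • ξ) - g x) - (G - g x) := by ring
      rw [e]
      refine (abs_sub _ _).trans ?_
      linarith
    rw [e]
    refine (key _ _ this).trans ?_
    rw [hD, mul_assoc, mul_assoc]
    refine mul_le_mul_of_nonneg_left ?_ (div_nonneg hL hc.le)
    -- This is exactly the slack left by the generous choice of `D`, which serves all three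
    -- estimates.
    have : 0 ≤ (E1 * ‖ξ‖ + E2 + E2 * ‖ξ‖ + 1) * τ := by positivity
    linarith
  · have e : τ * inner ℝ (G⁻¹ • a x) ξ = (τ * inner ℝ (a x) ξ) / G := by
      rw [real_inner_smul_left]; field_simp
    have : |τ * inner ℝ (a x) ξ| ≤ L * (τ * ‖ξ‖) := by
      rw [abs_mul, abs_of_nonneg hτ]
      have := (abs_real_inner_le_norm (a x) ξ).trans
        (mul_le_mul_of_nonneg_right (hg.grad_le x) hn)
      calc τ * |inner ℝ (a x) ξ| ≤ τ * (L * ‖ξ‖) := by gcongr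
        _ = L * (τ * ‖ξ‖) := by ring
    rw [e]
    refine (key _ _ this).trans ?_
    rw [hD, mul_assoc, mul_assoc]
    refine mul_le_mul_of_nonneg_left ?_ (div_nonneg hL hc.le)
    have : 0 ≤ (E1 * ‖ξ‖ + E2 + E2 * ‖ξ‖ + 1 + E1) * τ := by positivity
    linarith
  · have e : g (x + τ • ξ) / G - 1 - τ * inner ℝ (G⁻¹ • a x) ξ =
        (g (x + τ • ξ) - G - τ * inner ℝ (a x) ξ) / G := by
      rw [real_inner_smul_left]; field_simp
    have : |g (x + τ • ξ) - G - τ * inner ℝ (a x) ξ| ≤ L * ((τ * ‖ξ‖) ^ 2 + τ ^ 2 * E2) := by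
      have e : g (x + τ • ξ) - G - τ * inner ℝ (a x) ξ =
        (g (x + τ • ξ) - g x - τ * inner ℝ (a x) ξ) - (G - g x) := by ring
      rw [e]
      refine (abs_sub _ _).trans ?_
      linarith
    rw [e]
    refine (key _ _ this).trans ?_
    rw [hD, mul_assoc, mul_assoc]
    refine mul_le_mul_of_nonneg_left ?_ (div_nonneg hL hc.le)
    have : 0 ≤ τ ^ 2 * (1 + 2 * ‖ξ‖ + E1 * (1 + ‖ξ‖) ^ 2 + E2 * (2 * ‖ξ‖ + ‖ξ‖ ^ 2)) := by
      positivity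
    linarith

end SmoothBounded

variable {ι : Type*} [Fintype ι] {p : ι → ℝ} {P : ι → H →L[ℝ] H} {c L : ℝ}

/-- One step of the flow: expand the product around the averages `G j` to second order, then
integrate. `C` is chosen before the functions `g`, as the iteration requires. -/
theorem gaussAvg_prod_rpow_le (hp : ∀ j, 0 ≤ p j)
    (hP : ∀ v : ι → H, (∀ j, P j (v j) = v j) →
      ‖∑ j, p j • v j‖ ^ 2 ≤ ∑ j, p j * ‖v j‖ ^ 2)
    (hc : 0 < c) (hL : 0 ≤ L) :
    ∃ C : ℝ, 0 ≤ C ∧ ∀ (g : ι → H → ℝ) (a : ι → H → H),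
      (∀ j, SmoothBounded (P j) c L (g j) (a j)) → ∀ τ : ℝ, 0 ≤ τ → ∀ x : H,
        gaussAvg τ (fun y => ∏ j, g j y ^ p j) x ≤
          (1 + C * τ ^ 3) * ∏ j, gaussAvg τ (g j) x ^ p j := by
  -- Both a function and its average lie in `[c, L]`, so their quotient is between `0` and `L / c`.
  obtain ⟨C₁, hC₁, h₁⟩ := prod_one_add_rpow_le hp (W := L / c + 1) (by positivity)
  obtain ⟨D, hD⟩ : ∃ D : ℝ, D = L / c * (1 + (∫ ξ : H, ‖ξ‖ ^ 1 ∂(stdGaussian H)) +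
      ∫ ξ : H, ‖ξ‖ ^ 2 ∂(stdGaussian H)) := ⟨_, rfl⟩
  have hD0 : 0 ≤ D := by
    have h1 : 0 ≤ ∫ ξ : H, ‖ξ‖ ^ 1 ∂(stdGaussian H) := integral_nonneg fun ξ => by positivity
    have h2 : 0 ≤ ∫ ξ : H, ‖ξ‖ ^ 2 ∂(stdGaussian H) := integral_nonneg fun ξ => by positivity
    rw [hD]; positivity
  have hP0 : 0 ≤ ∑ j, p j := Finset.sum_nonneg fun j _ => hp j
  set C₂ : ℝ := C₁ * D ^ 3 + ((∑ j, p j) ^ 2 + ∑ j, p j) * D ^ 2 with hC₂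
  have hC₂0 : 0 ≤ C₂ := by positivity
  have hE3 : 0 ≤ ∫ ξ : H, (1 + ‖ξ‖) ^ 3 ∂(stdGaussian H) :=
    integral_nonneg fun ξ => by positivity
  refine ⟨C₂ * ∫ ξ : H, (1 + ‖ξ‖) ^ 3 ∂(stdGaussian H), by positivity,
    fun g a hg τ hτ x => ?_⟩
  have hGpos : ∀ j, 0 < gaussAvg τ (g j) x := fun j =>
    hc.trans_le (((hg j).gaussAvg hc.le τ).lower x)
  set G : ι → ℝ := fun j => gaussAvg τ (g j) x with hG
  set ℓ : ι → H := fun j => (G j)⁻¹ • a j x with hℓ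
  set v : H := ∑ j, p j • ℓ j with hv
  have pointwise : ∀ ξ : H, ∏ j, g j (x + τ • ξ) ^ p j ≤ (∏ j, G j ^ p j) *
      (1 + ∑ j, p j * (g j (x + τ • ξ) / G j - 1) +
        τ ^ 2 / 2 * ((inner ℝ v ξ) ^ 2 - ∑ j, p j * (inner ℝ (ℓ j) ξ) ^ 2) +
        C₂ * τ ^ 3 * (1 + ‖ξ‖) ^ 3) := by
    intro ξ
    have hb := fun j => (hg j).fluctuation_bounds hc hD hτ x ξ
    have hgc : ∀ j, 0 < g j (x + τ • ξ) := fun j => hc.trans_le ((hg j).lower _)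
    have e : ∏ j, g j (x + τ • ξ) ^ p j =
        (∏ j, G j ^ p j) * ∏ j, (1 + (g j (x + τ • ξ) / G j - 1)) ^ p j := by
      rw [← Finset.prod_mul_distrib]
      refine Finset.prod_congr rfl fun j _ => ?_
      have : (1 + (g j (x + τ • ξ) / G j - 1)) = g j (x + τ • ξ) / G j := by ring
      rw [this, ← Real.mul_rpow (hGpos j).le (div_pos (hgc j) (hGpos j)).le,
        mul_div_cancel₀ _ (hGpos j).ne']
    rw [e]
    refine mul_le_mul_of_nonneg_left ?_
      (Finset.prod_nonneg fun j _ => Real.rpow_nonneg (hGpos j).le _)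
    have hr : 0 ≤ D * τ * (1 + ‖ξ‖) := by positivity
    have hW : ∀ j, |g j (x + τ • ξ) / G j - 1| ≤ L / c + 1 := by
      intro j
      have h3 : g j (x + τ • ξ) / G j ≤ L / c :=
        div_le_div₀ hL ((hg j).upper _) hc (((hg j).gaussAvg hc.le τ).lower x)
      have h4 := div_pos (hgc j) (hGpos j)
      rw [_root_.abs_le]
      constructor <;> linarith
    have s1 := h₁ (fun j => g j (x + τ • ξ) / G j - 1) _ hr
      (fun j => by linarith [div_pos (hgc j) (hGpos j)]) hW (fun j => (hb j).1)
    have s2 := quadratic_form_compare hp (fun j => (hb j).1) (fun j => (hb j).2.1)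
      (fun j => (hb j).2.2) (by positivity)
    have e1 : ∑ j, p j * (τ * inner ℝ ((gaussAvg τ (g j) x)⁻¹ • a j x) ξ) =
        τ * inner ℝ v ξ := by
      rw [hv, sum_inner, Finset.mul_sum]
      refine Finset.sum_congr rfl fun j _ => ?_
      simp only [hℓ, hG, real_inner_smul_left]
      ring
    have e2 : ∑ j, p j * (τ * inner ℝ ((gaussAvg τ (g j) x)⁻¹ • a j x) ξ) ^ 2 =
        τ ^ 2 * ∑ j, p j * (inner ℝ (ℓ j) ξ) ^ 2 := by
      rw [Finset.mul_sum]
      refine Finset.sum_congr rfl fun j _ => ?_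
      ring
    rw [e1, e2] at s2
    have e3 : C₂ * τ ^ 3 * (1 + ‖ξ‖) ^ 3 = C₁ * (D * τ * (1 + ‖ξ‖)) ^ 3 +
      2 * ((∑ j, p j) ^ 2 + ∑ j, p j) *
        (D * τ ^ 2 * (1 + ‖ξ‖) ^ 2 * (D * τ * (1 + ‖ξ‖))) / 2 := by
      rw [hC₂]; ring
    rw [e3]
    simp only [hG] at s1 ⊢
    linarith
  have hiw : ∀ j, Integrable (fun ξ => p j * (g j (x + τ • ξ) / G j - 1)) (stdGaussian H) :=
    fun j => ((((hg j).integrable hc.le τ x).div_const _).sub (integrable_const _)).const_mul _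
  have hi1 : Integrable (fun ξ => 1 + ∑ j, p j * (g j (x + τ • ξ) / G j - 1))
      (stdGaussian H) :=
    (integrable_const _).add (integrable_finsetSum _ fun j _ => hiw j)
  have hi2s : Integrable (fun ξ => ∑ j, p j * (inner ℝ (ℓ j) ξ) ^ 2) (stdGaussian H) :=
    integrable_finsetSum _ fun j _ => (integrable_inner_sq_stdGaussian _).const_mul _
  have hi2 : Integrable (fun ξ => τ ^ 2 / 2 *
      ((inner ℝ v ξ) ^ 2 - ∑ j, p j * (inner ℝ (ℓ j) ξ) ^ 2)) (stdGaussian H) :=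
    ((integrable_inner_sq_stdGaussian _).sub hi2s).const_mul _
  have hi3 : Integrable (fun ξ : H => C₂ * τ ^ 3 * (1 + ‖ξ‖) ^ 3) (stdGaussian H) :=
    (integrable_one_add_norm_pow_stdGaussian 3).const_mul _
  -- Normalising by the average, rather than by `g j x`, makes the first-order term integrate to
  -- exactly zero.
  have v1 : ∫ ξ, (1 + ∑ j, p j * (g j (x + τ • ξ) / G j - 1)) ∂(stdGaussian H) = 1 := by
    rw [integral_add (integrable_const _) (integrable_finsetSum _ fun j _ => hiw j),
      integral_finsetSum _ fun j _ => hiw j]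
    have : ∀ j, ∫ ξ, p j * (g j (x + τ • ξ) / G j - 1) ∂(stdGaussian H) = 0 := by
      intro j
      rw [integral_const_mul, integral_sub (((hg j).integrable hc.le τ x).div_const _)
        (integrable_const _), integral_div]
      have : ∫ ξ, g j (x + τ • ξ) ∂(stdGaussian H) = G j := rfl
      rw [this, div_self (hGpos j).ne']
      simp
    simp [this]
  -- Since `⟪v, ξ⟫²` has mean `‖v‖²`, this is the sign condition `hP` for the normalised gradients
  -- `ℓ j`, which are fixed by `P j`.
  have v2 : ∫ ξ, τ ^ 2 / 2 * ((inner ℝ v ξ) ^ 2 - ∑ j, p j * (inner ℝ (ℓ j) ξ) ^ 2)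
      ∂(stdGaussian H) ≤ 0 := by
    rw [integral_const_mul, integral_sub (integrable_inner_sq_stdGaussian _) hi2s,
      integral_finsetSum _ fun j _ => (integrable_inner_sq_stdGaussian _).const_mul _]
    simp_rw [integral_const_mul, integral_inner_sq_stdGaussian]
    refine mul_nonpos_of_nonneg_of_nonpos (by positivity) (sub_nonpos.2 (hP ℓ fun j => ?_))
    rw [hℓ, map_smul, (hg j).fixed]
  have hprod0 : 0 ≤ ∏ j, G j ^ p j :=
    Finset.prod_nonneg fun j _ => Real.rpow_nonneg (hGpos j).le _
  have hint := integral_mono_of_nonneg (μ := stdGaussian H)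
    (.of_forall fun ξ => Finset.prod_nonneg fun j _ =>
      Real.rpow_nonneg (hc.le.trans ((hg j).lower _)) _)
    (((hi1.add hi2).add hi3).const_mul (∏ j, G j ^ p j)) (.of_forall pointwise)
  refine hint.trans ?_
  rw [integral_const_mul, mul_comm]
  refine mul_le_mul_of_nonneg_right ?_ hprod0
  have e : ∫ ξ, ((1 + ∑ j, p j * (g j (x + τ • ξ) / G j - 1)) + τ ^ 2 / 2 *
      ((inner ℝ v ξ) ^ 2 - ∑ j, p j * (inner ℝ (ℓ j) ξ) ^ 2) + C₂ * τ ^ 3 * (1 + ‖ξ‖) ^ 3)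
      ∂(stdGaussian H) = 1 + (∫ ξ, τ ^ 2 / 2 *
      ((inner ℝ v ξ) ^ 2 - ∑ j, p j * (inner ℝ (ℓ j) ξ) ^ 2) ∂(stdGaussian H)) +
      C₂ * τ ^ 3 * ∫ ξ : H, (1 + ‖ξ‖) ^ 3 ∂(stdGaussian H) := by
    refine (integral_add (hi1.add hi2) hi3).trans ?_
    rw [integral_const_mul]
    congr 1
    exact (integral_add hi1 hi2).trans (by rw [v1])
  refine e.trans_le ?_
  linarith

/-- Averaging the one-step inequality over the remaining `k` steps reduces to the induction
hypothesis for the averaged functions, which lie in the same class. The induction therefore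
quantifies over all `g`. -/
theorem gaussAvg_iterate_prod_rpow_le (hp : ∀ j, 0 ≤ p j) (hc : 0 < c) {C τ : ℝ} (hC : 0 ≤ C)
    (hτ : 0 ≤ τ)
    (h : ∀ (g : ι → H → ℝ) (a : ι → H → H),
      (∀ j, SmoothBounded (P j) c L (g j) (a j)) → ∀ x : H,
        gaussAvg τ (fun y => ∏ j, g j y ^ p j) x ≤
          (1 + C * τ ^ 3) * ∏ j, gaussAvg τ (g j) x ^ p j) (k : ℕ) :
    ∀ (g : ι → H → ℝ) (a : ι → H → H),
      (∀ j, SmoothBounded (P j) c L (g j) (a j)) → ∀ x : H,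
        gaussAvg (√k * τ) (fun y => ∏ j, g j y ^ p j) x ≤
          (1 + C * τ ^ 3) ^ k * ∏ j, gaussAvg (√k * τ) (g j) x ^ p j := by
  induction k with
  | zero => intro g a hg x; simp [gaussAvg]
  | succ k ih =>
    intro g a hg x
    have hcont : ∀ g : ι → H → ℝ, ∀ a : ι → H → H,
        (∀ j, SmoothBounded (P j) c L (g j) (a j)) →
        Continuous (fun y => ∏ j, g j y ^ p j) ∧ ∀ y, |∏ j, g j y ^ p j| ≤ ∏ j, L ^ p j := by
      intro g a hg
      refine ⟨continuous_finsetProd _ fun j _ =>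
        (hg j).continuous.rpow_const fun y => .inr (hp j), fun y => ?_⟩
      rw [Finset.abs_prod]
      refine Finset.prod_le_prod (fun j _ => abs_nonneg _) fun j _ => ?_
      have h0 : 0 ≤ g j y := hc.le.trans ((hg j).lower y)
      rw [abs_of_nonneg (Real.rpow_nonneg h0 _)]
      exact Real.rpow_le_rpow h0 ((hg j).upper y) (hp j)
    have hs : √((√k * τ) ^ 2 + τ ^ 2) = √(k + 1 : ℕ) * τ := by
      rw [mul_pow, Real.sq_sqrt (Nat.cast_nonneg k), ← add_one_mul, Real.sqrt_mul (by positivity),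
        Real.sqrt_sq hτ]
      push_cast
      rfl
    rw [← hs, ← gaussAvg_gaussAvg (hcont g a hg).1 (hcont g a hg).2]
    simp_rw [← gaussAvg_gaussAvg (hg _).continuous ((hg _).abs_le hc.le)]
    have hg' := fun j => (hg j).gaussAvg hc.le τ
    have step : gaussAvg (√k * τ) (gaussAvg τ (fun y => ∏ j, g j y ^ p j)) x ≤
        (1 + C * τ ^ 3) * gaussAvg (√k * τ) (fun y => ∏ j, gaussAvg τ (g j) y ^ p j) x := by
      have hc' := hcont _ _ hg'
      have hcc := hc'.1
      unfold gaussAvg at hcc hc' ⊢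
      rw [← integral_const_mul]
      refine integral_mono_of_nonneg (.of_forall fun ξ => integral_nonneg fun η =>
        Finset.prod_nonneg fun j _ => Real.rpow_nonneg (hc.le.trans ((hg j).lower _)) _)
        ((Integrable.of_bound ?_ _ (.of_forall fun ξ => hc'.2 _)).const_mul _)
        (.of_forall fun ξ => h g a hg _)
      exact (hcc.comp (by fun_prop)).aestronglyMeasurable
    refine step.trans ?_
    rw [pow_succ' (1 + C * τ ^ 3), mul_assoc]
    exact mul_le_mul_of_nonneg_left (ih _ _ hg' x) (by positivity)

/-- With `n` steps of size `1 / √n` the total variance is one, while the error factor is at most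
`exp (C / √n)`, which tends to one. -/
theorem integral_prod_rpow_le_of_smoothBounded (hp : ∀ j, 0 ≤ p j)
    (hP : ∀ v : ι → H, (∀ j, P j (v j) = v j) →
      ‖∑ j, p j • v j‖ ^ 2 ≤ ∑ j, p j * ‖v j‖ ^ 2)
    (hc : 0 < c) {g : ι → H → ℝ} {a : ι → H → H}
    (hg : ∀ j, SmoothBounded (P j) c L (g j) (a j)) :
    ∫ ξ, ∏ j, g j ξ ^ p j ∂(stdGaussian H) ≤
      ∏ j, (∫ ξ, g j ξ ∂(stdGaussian H)) ^ p j := by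
  -- `0 ≤ L` is only available from an actual index.
  rcases isEmpty_or_nonempty ι with hι | ⟨⟨j₀⟩⟩
  · simp
  have hL : 0 ≤ L := (norm_nonneg _).trans ((hg j₀).grad_le 0)
  obtain ⟨C, hC, h⟩ := gaussAvg_prod_rpow_le hp hP hc hL
  have key : ∀ n : ℕ, 0 < n → ∫ ξ, ∏ j, g j ξ ^ p j ∂(stdGaussian H) ≤
      Real.exp (C * (√n)⁻¹) * ∏ j, (∫ ξ, g j ξ ∂(stdGaussian H)) ^ p j := by
    intro n hn
    have hn' : (0 : ℝ) < n := Nat.cast_pos.2 hn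
    have hs : √(n : ℝ) ≠ 0 := (Real.sqrt_pos.2 hn').ne'
    have h1 := gaussAvg_iterate_prod_rpow_le hp hc hC (τ := (√n)⁻¹) (by positivity)
      (fun g a hg x => h g a hg _ (by positivity) x) n g a hg 0
    rw [mul_inv_cancel₀ hs] at h1
    simp only [gaussAvg, zero_add, one_smul] at h1
    refine h1.trans (mul_le_mul_of_nonneg_right ?_ (Finset.prod_nonneg fun j _ =>
      Real.rpow_nonneg (integral_nonneg fun ξ => hc.le.trans ((hg j).lower _)) _))
    calc (1 + C * (√n)⁻¹ ^ 3) ^ n ≤ (Real.exp (C * (√n)⁻¹ ^ 3)) ^ n := by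
          refine pow_le_pow_left₀ (by positivity) ?_ n
          linarith [Real.add_one_le_exp (C * (√n)⁻¹ ^ 3)]
      _ = Real.exp (C * (√n)⁻¹) := by
          rw [← Real.exp_nat_mul]
          congr 1
          have : (n : ℝ) = √n ^ 2 := (Real.sq_sqrt hn'.le).symm
          calc (n : ℝ) * (C * (√n)⁻¹ ^ 3) = √n ^ 2 * (C * (√n)⁻¹ ^ 3) := by rw [← this]
            _ = C * (√n)⁻¹ := by field_simp
  have hlim : Tendsto (fun n : ℕ => Real.exp (C * (√n)⁻¹) *
      ∏ j, (∫ ξ, g j ξ ∂(stdGaussian H)) ^ p j) atTop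
      (𝓝 (Real.exp (C * 0) * ∏ j, (∫ ξ, g j ξ ∂(stdGaussian H)) ^ p j)) := by
    refine Tendsto.mul_const _ ((Real.continuous_exp.tendsto _).comp (Tendsto.const_mul _ ?_))
    exact (Real.tendsto_sqrt_atTop.comp tendsto_natCast_atTop_atTop).inv_tendsto_atTop
  have := ge_of_tendsto hlim ((eventually_gt_atTop 0).mono key)
  simpa using this

end HeatFlowMonotonicity

/-! ### The standard gaussian measure: its density and its images under coisometries. -/

section GaussianDensity

variable {H : Type*} [NormedAddCommGroup H] [InnerProductSpace ℝ H]

/-- The density of the standard gaussian with respect to Lebesgue measure. -/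
noncomputable def gaussDensity (x : H) : ℝ :=
  (2 * Real.pi) ^ (-(Module.finrank ℝ H : ℝ) / 2) * Real.exp (-(‖x‖ ^ 2 / 2))

theorem gaussDensity_pos (x : H) : 0 < gaussDensity x := by
  unfold gaussDensity
  positivity

theorem continuous_gaussDensity : Continuous (gaussDensity : H → ℝ) := by
  unfold gaussDensity
  fun_prop

variable [FiniteDimensional ℝ H] [MeasurableSpace H] [BorelSpace H]

theorem stdGaussian_eq_withDensity :
    stdGaussian H = volume.withDensity (fun x : H => ENNReal.ofReal (gaussDensity x)) := by
  have hre : 0 < ((1 / 2 : ℂ)).re := by norm_num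
  have hcint := GaussianFourier.integrable_cexp_neg_mul_sq_norm_add (V := H) hre 0 0
  have hint : Integrable (fun x : H => gaussDensity x) := by
    have h := hcint.norm.const_mul ((2 * Real.pi) ^ (-(Module.finrank ℝ H : ℝ) / 2))
    refine h.congr (.of_forall fun x => ?_)
    simp only [gaussDensity, Complex.norm_exp]
    congr 2
    simp [← Complex.ofReal_pow]
    ring
  have : IsFiniteMeasure (volume.withDensity (fun x : H => ENNReal.ofReal (gaussDensity x))) :=
    isFiniteMeasure_withDensity_ofReal hint.2
  apply Measure.ext_of_charFun
  ext t
  rw [charFun_stdGaussian, charFun_apply]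
  have e := integral_withDensity_eq_integral_smul (μ := (volume : Measure H))
    (f := fun x => (gaussDensity x).toNNReal) (continuous_gaussDensity.measurable.real_toNNReal)
    (fun x => Complex.exp ((inner ℝ x t : ℝ) * Complex.I))
  have e' : (volume.withDensity fun x : H => ENNReal.ofReal (gaussDensity x)) =
    volume.withDensity fun x : H => ((gaussDensity x).toNNReal : ℝ≥0∞) := rfl
  rw [e', e]
  have e2 : ∀ x : H, (gaussDensity x).toNNReal • Complex.exp ((inner ℝ x t : ℝ) * Complex.I) =
      (((2 * Real.pi) ^ (-(Module.finrank ℝ H : ℝ) / 2) : ℝ) : ℂ) *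
        Complex.exp (-(1 / 2 : ℂ) * (‖x‖ : ℂ) ^ 2 + Complex.I * (inner ℝ t x : ℝ)) := by
    intro x
    rw [NNReal.smul_def, Real.coe_toNNReal _ (gaussDensity_pos x).le, Complex.real_smul,
      gaussDensity, Complex.ofReal_mul, mul_assoc, Complex.ofReal_exp, ← Complex.exp_add,
      real_inner_comm]
    congr 2
    push_cast
    ring
  simp_rw [e2]
  rw [integral_const_mul, GaussianFourier.integral_cexp_neg_mul_sq_norm_add hre]
  have hpi : (Real.pi : ℂ) / (1 / 2) = ((2 * Real.pi : ℝ) : ℂ) := by push_cast; ring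
  have hd : ((Module.finrank ℝ H : ℂ) / 2) = (((Module.finrank ℝ H : ℝ) / 2 : ℝ) : ℂ) := by
    push_cast; rfl
  have hpos : 0 < 2 * Real.pi := by positivity
  rw [hpi, hd, ← Complex.ofReal_cpow hpos.le, ← mul_assoc, ← Complex.ofReal_mul,
    ← Real.rpow_add hpos]
  have : -(Module.finrank ℝ H : ℝ) / 2 + (Module.finrank ℝ H : ℝ) / 2 = 0 := by ring
  rw [this, Real.rpow_zero, Complex.ofReal_one, one_mul, Complex.I_sq]
  congr 1
  ring

theorem lintegral_stdGaussian {f : H → ℝ≥0∞} (hf : Measurable f) :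
    ∫⁻ x, f x ∂(stdGaussian H) = ∫⁻ x, ENNReal.ofReal (gaussDensity x) * f x := by
  rw [stdGaussian_eq_withDensity, lintegral_withDensity_eq_lintegral_mul _
    continuous_gaussDensity.measurable.ennreal_ofReal hf]
  rfl

/-- The image has characteristic function `exp (-‖B* t‖² / 2)`, and `B*` is isometric. -/
theorem map_stdGaussian_of_comp_adjoint_eq_id {K : Type*} [NormedAddCommGroup K]
    [InnerProductSpace ℝ K] [FiniteDimensional ℝ K] [MeasurableSpace K] [BorelSpace K]
    {B : H →L[ℝ] K}
    (hB : B ∘L ContinuousLinearMap.adjoint B = ContinuousLinearMap.id ℝ K) :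
    (stdGaussian H).map B = stdGaussian K := by
  have : IsProbabilityMeasure ((stdGaussian H).map B) :=
    Measure.isProbabilityMeasure_map (by fun_prop)
  apply Measure.ext_of_charFun
  ext t
  rw [charFun_apply, integral_map (by fun_prop) (by fun_prop)]
  simp_rw [← ContinuousLinearMap.adjoint_inner_right]
  rw [← charFun_apply, charFun_stdGaussian, charFun_stdGaussian]
  have : ‖ContinuousLinearMap.adjoint B t‖ ^ 2 = ‖t‖ ^ 2 := by
    rw [← real_inner_self_eq_norm_sq, ContinuousLinearMap.adjoint_inner_left,
      ← ContinuousLinearMap.comp_apply, hB]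
    simp
  norm_cast
  rw [this]

end GaussianDensity

/-! ### Smooth approximation, and admissible functions of the form `f ∘ B + c`. -/

section Approximation

theorem exists_smooth_bounds {K : Type*} [NormedAddCommGroup K] [NormedSpace ℝ K]
    {f : K → ℝ} (hc : HasCompactSupport f) (hf : ContDiff ℝ 2 f) :
    ∃ M : ℝ, 0 ≤ M ∧ (∀ y, |f y| ≤ M) ∧ (∀ y, ‖fderiv ℝ f y‖ ≤ M) ∧
      (∀ y h, |f (y + h) - f y| ≤ M * ‖h‖) ∧
      ∀ y h, |f (y + h) - f y - fderiv ℝ f y h| ≤ M * ‖h‖ ^ 2 := by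
  have hf' : ContDiff ℝ 1 (fderiv ℝ f) := hf.fderiv_right (by norm_num)
  obtain ⟨M₀, h₀⟩ := hc.exists_bound_of_continuous hf.continuous
  obtain ⟨M₁, h₁⟩ := (hc.fderiv ℝ).exists_bound_of_continuous hf'.continuous
  obtain ⟨M₂, h₂⟩ := hf'.lipschitzWith_of_hasCompactSupport (hc.fderiv ℝ) (by norm_num)
  have m0 : 0 ≤ M₀ := (norm_nonneg _).trans (h₀ 0)
  have m1 : 0 ≤ M₁ := (norm_nonneg _).trans (h₁ 0)
  have m2 : 0 ≤ (M₂ : ℝ) := M₂.2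
  have hd : ∀ z, HasFDerivAt f (fderiv ℝ f z) z := fun z =>
    (hf.differentiable (by norm_num) z).hasFDerivAt
  refine ⟨M₀ + M₁ + M₂, by positivity, fun y => (h₀ y).trans (by linarith),
    fun y => (h₁ y).trans (by linarith), fun y h => ?_, fun y h => ?_⟩
  · have := convex_univ.norm_image_sub_le_of_norm_hasFDerivWithin_le (f := f) (x := y)
      (y := y + h) (fun z _ => (hd z).hasFDerivWithinAt) (fun z _ => h₁ z) (mem_univ _)
      (mem_univ _)
    rw [add_sub_cancel_left, Real.norm_eq_abs] at this
    exact this.trans (by gcongr; linarith)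
  · have := (convex_closedBall y ‖h‖).norm_image_sub_le_of_norm_hasFDerivWithin_le' (f := f)
      (x := y) (y := y + h) (φ := fderiv ℝ f y) (C := M₂ * ‖h‖)
      (fun z _ => (hd z).hasFDerivWithinAt)
      (fun z hz => (h₂.norm_sub_le z y).trans (by
        gcongr; simpa [dist_eq_norm] using hz))
      (Metric.mem_closedBall_self (norm_nonneg _)) (by simp)
    rw [add_sub_cancel_left, Real.norm_eq_abs] at this
    refine this.trans ?_
    rw [mul_assoc, ← sq]
    gcongr
    linarith

variable {H : Type*} [NormedAddCommGroup H] [InnerProductSpace ℝ H] [FiniteDimensional ℝ H]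
  {K : Type*} [NormedAddCommGroup K] [InnerProductSpace ℝ K] [FiniteDimensional ℝ K]

theorem norm_adjoint_apply_of_comp_adjoint_eq_id {B : H →L[ℝ] K}
    (hB : B ∘L ContinuousLinearMap.adjoint B = ContinuousLinearMap.id ℝ K) (y : K) :
    ‖ContinuousLinearMap.adjoint B y‖ = ‖y‖ := by
  have : ‖ContinuousLinearMap.adjoint B y‖ ^ 2 = ‖y‖ ^ 2 := by
    rw [← real_inner_self_eq_norm_sq, ContinuousLinearMap.adjoint_inner_left,
      ← ContinuousLinearMap.comp_apply, hB]
    simp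
  exact (pow_left_inj₀ (norm_nonneg _) (norm_nonneg _) two_ne_zero).1 this

theorem norm_apply_le_of_comp_adjoint_eq_id {B : H →L[ℝ] K}
    (hB : B ∘L ContinuousLinearMap.adjoint B = ContinuousLinearMap.id ℝ K) (x : H) :
    ‖B x‖ ≤ ‖x‖ := by
  have h : ‖B x‖ * ‖B x‖ ≤ ‖x‖ * ‖B x‖ := by
    calc ‖B x‖ * ‖B x‖ = inner ℝ x (ContinuousLinearMap.adjoint B (B x)) := by
          rw [ContinuousLinearMap.adjoint_inner_right, real_inner_self_eq_norm_mul_norm]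
      _ ≤ ‖x‖ * ‖ContinuousLinearMap.adjoint B (B x)‖ := real_inner_le_norm _ _
      _ = ‖x‖ * ‖B x‖ := by rw [norm_adjoint_apply_of_comp_adjoint_eq_id hB]
  rcases (norm_nonneg (B x)).eq_or_lt with h0 | h0
  · rw [← h0]; exact norm_nonneg _
  · exact le_of_mul_le_mul_right h h0

/-- The gradient of `f ∘ B` is `B* (∇f ∘ B)`, fixed by `B* B` because `B B* = id`. Allowing every
`L' ≥ L` lets finitely many functions share one bound. -/
theorem exists_smoothBounded_comp {B : H →L[ℝ] K}
    (hB : B ∘L ContinuousLinearMap.adjoint B = ContinuousLinearMap.id ℝ K) {f : K → ℝ}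
    (hc : HasCompactSupport f) (hf : ContDiff ℝ 2 f) (h0 : ∀ y, 0 ≤ f y) {c : ℝ} (hc0 : 0 < c) :
    ∃ (L : ℝ) (a : H → H), ∀ L' ≥ L,
      SmoothBounded (ContinuousLinearMap.adjoint B ∘L B) c L' (fun x => f (B x) + c) a := by
  obtain ⟨M, hM, b0, b1, b2, b3⟩ := exists_smooth_bounds hc hf
  have hf' : Continuous (fderiv ℝ f) := hf.continuous_fderiv (by norm_num)
  refine ⟨M + c, fun x => ContinuousLinearMap.adjoint B
    ((InnerProductSpace.toDual ℝ K).symm (fderiv ℝ f (B x))), fun L' hL' => ⟨by fun_prop,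
      fun x => ?_, fun x => by linarith [h0 (B x)], fun x => ?_, fun x => ?_, fun x h => ?_,
      fun x h => ?_⟩⟩
  · have := DFunLike.congr_fun hB
      ((InnerProductSpace.toDual ℝ K).symm (fderiv ℝ f (B x)))
    simp only [ContinuousLinearMap.comp_apply, ContinuousLinearMap.id_apply] at this ⊢
    rw [this]
  · linarith [le_of_abs_le (b0 (B x))]
  · rw [norm_adjoint_apply_of_comp_adjoint_eq_id hB, LinearIsometryEquiv.norm_map]
    linarith [b1 (B x)]
  · have hn := norm_apply_le_of_comp_adjoint_eq_id hB h
    rw [map_add, add_sub_add_right_eq_sub]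
    refine (b2 _ _).trans (mul_le_mul (by linarith) hn (norm_nonneg _) (by linarith))
  · have hn := norm_apply_le_of_comp_adjoint_eq_id hB h
    rw [map_add, add_sub_add_right_eq_sub, ContinuousLinearMap.adjoint_inner_left,
      InnerProductSpace.toDual_symm_apply]
    exact (b3 _ _).trans (mul_le_mul (by linarith) (pow_le_pow_left₀ (norm_nonneg _) hn 2)
      (by positivity) (by linarith))

/-- Approximating `√F` in `L²` and squaring gives approximants that are automatically nonnegative
and whose integrals are controlled by the triangle inequality; a subsequence converges almost
everywhere. -/
theorem exists_smooth_sq_approx [MeasurableSpace K] [BorelSpace K] (μ : Measure K)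
    [IsFiniteMeasureOnCompacts μ] {F : K → ℝ≥0} (hF : Measurable F)
    (hfin : ∫⁻ y, (F y : ℝ≥0∞) ∂μ < ∞) :
    ∃ φ : ℕ → K → ℝ, (∀ n, HasCompactSupport (φ n) ∧ ContDiff ℝ 2 (φ n)) ∧
      (∀ᵐ y ∂μ, Tendsto (fun n => φ n y ^ 2) atTop (𝓝 (F y))) ∧
      ∀ n : ℕ, ∫⁻ y, ENNReal.ofReal (φ n y ^ 2) ∂μ ≤
        ((∫⁻ y, (F y : ℝ≥0∞) ∂μ) ^ (1 / 2 : ℝ) + ENNReal.ofReal (1 / (n + 1 : ℝ))) ^ 2 := by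
  have hsq : ∀ g : K → ℝ, eLpNorm g 2 μ = (∫⁻ y, ENNReal.ofReal (g y ^ 2) ∂μ) ^ (1 / 2 : ℝ) := by
    intro g
    rw [eLpNorm_eq_lintegral_rpow_enorm_toReal two_ne_zero ENNReal.ofNat_ne_top]
    simp only [ENNReal.toReal_ofNat]
    congr 2
    ext y
    rw [Real.enorm_eq_ofReal_abs, ENNReal.ofReal_rpow_of_nonneg (abs_nonneg _) (by norm_num)]
    congr 1
    norm_num
  set s : K → ℝ := fun y => √(F y : ℝ) with hs
  have hsm : Measurable s := (measurable_coe_nnreal_real.comp hF).sqrt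
  have hs2 : ∀ y, ENNReal.ofReal (s y ^ 2) = F y := by
    intro y
    simp only [hs]
    rw [Real.sq_sqrt (NNReal.coe_nonneg (F y)), ENNReal.ofReal_coe_nnreal]
  have hsN : eLpNorm s 2 μ = (∫⁻ y, (F y : ℝ≥0∞) ∂μ) ^ (1 / 2 : ℝ) := by
    rw [hsq]; simp_rw [hs2]
  have hsL : MemLp s 2 μ := ⟨hsm.aestronglyMeasurable, by
    rw [hsN]; exact ENNReal.rpow_lt_top_of_nonneg (by norm_num) hfin.ne⟩
  have hpos : ∀ n : ℕ, (0 : ℝ) < 1 / (n + 1 : ℝ) := fun n => by positivity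
  choose ψ h1 h2 h3 using fun n : ℕ =>
    hsL.exist_eLpNorm_sub_le ENNReal.ofNat_ne_top one_le_two (hpos n)
  have hψm : ∀ n, AEStronglyMeasurable (ψ n) μ := fun n => (h2 n).continuous.aestronglyMeasurable
  have hlim : Tendsto (fun n => eLpNorm (ψ n - s) 2 μ) atTop (𝓝 0) := by
    refine tendsto_of_tendsto_of_tendsto_of_le_of_le tendsto_const_nhds
      (h := fun n : ℕ => ENNReal.ofReal (1 / (n + 1 : ℝ))) ?_ (fun n => zero_le) (fun n => ?_)
    · have := ENNReal.tendsto_ofReal (tendsto_one_div_add_atTop_nhds_zero_nat (𝕜 := ℝ))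
      simpa using this
    · show eLpNorm (ψ n - s) 2 μ ≤ _
      rw [eLpNorm_sub_comm]; exact h3 n
  obtain ⟨ns, hns, hae⟩ := (tendstoInMeasure_of_tendsto_eLpNorm two_ne_zero hψm
    hsm.aestronglyMeasurable hlim).exists_seq_tendsto_ae
  refine ⟨fun n => ψ (ns n), fun n => ⟨h1 _, by exact_mod_cast contDiff_infty.1 (h2 (ns n)) 2⟩, ?_, fun n => ?_⟩
  · filter_upwards [hae] with y hy
    have := hy.pow 2
    simp only [hs] at this
    rwa [Real.sq_sqrt (NNReal.coe_nonneg (F y))] at this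
  · have h4 : eLpNorm (ψ (ns n)) 2 μ ≤ (∫⁻ y, (F y : ℝ≥0∞) ∂μ) ^ (1 / 2 : ℝ) +
        ENNReal.ofReal (1 / (n + 1 : ℝ)) := by
      have e : ψ (ns n) = s - (s - ψ (ns n)) := by simp
      rw [← hsN]
      nth_rewrite 1 [e]
      refine (eLpNorm_sub_le hsm.aestronglyMeasurable
        (hsm.aestronglyMeasurable.sub (hψm _)) one_le_two).trans ?_
      refine add_le_add le_rfl ((h3 (ns n)).trans (ENNReal.ofReal_le_ofReal ?_))
      -- Passing to a subsequence only improves the rate `1 / (n + 1)`.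
      have : (n : ℝ) ≤ ns n := Nat.cast_le.2 (hns.id_le n)
      gcongr
    rw [hsq] at h4
    calc ∫⁻ y, ENNReal.ofReal (ψ (ns n) y ^ 2) ∂μ =
        ((∫⁻ y, ENNReal.ofReal (ψ (ns n) y ^ 2) ∂μ) ^ (1 / 2 : ℝ)) ^ 2 := by
          rw [← ENNReal.rpow_natCast, ← ENNReal.rpow_mul]; norm_num
      _ ≤ _ := by gcongr

end Approximation

/-! ### The Brascamp–Lieb inequality for geometric data. -/

namespace BLDatum

variable {m : ℕ} {H : Type*} [NormedAddCommGroup H] [InnerProductSpace ℝ H]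
  [FiniteDimensional ℝ H] {K : Fin m → Type*}
  [∀ j, NormedAddCommGroup (K j)] [∀ j, InnerProductSpace ℝ (K j)]
  [∀ j, FiniteDimensional ℝ (K j)]

theorem Geometric.sum_mul_norm_sq {D : BLDatum H K} (hD : D.Geometric) (x : H) :
    ∑ j, D.p j * ‖D.B j x‖ ^ 2 = ‖x‖ ^ 2 := by
  have h := congrArg (fun T : H →L[ℝ] H => inner ℝ (T x) x) hD.2
  simp only [_root_.sum_apply, _root_.smul_apply, sum_inner,
    real_inner_smul_left, ContinuousLinearMap.comp_apply, ContinuousLinearMap.adjoint_inner_left,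
    real_inner_self_eq_norm_sq, ContinuousLinearMap.id_apply] at h
  exact h

/-- Pair `s` with itself: `‖s‖² = ∑ p_j ⟪B_j v_j, B_j s⟫`. By AM–GM this is at most half of `∑ p_j
‖v_j‖² + ‖s‖²`, and the last term is absorbed. This supplies the sign condition of the heat flow. -/
theorem Geometric.norm_sum_sq_le {D : BLDatum H K} (hD : D.Geometric) (v : Fin m → H)
    (hv : ∀ j, (ContinuousLinearMap.adjoint (D.B j) ∘L D.B j) (v j) = v j) :
    ‖∑ j, D.p j • v j‖ ^ 2 ≤ ∑ j, D.p j * ‖v j‖ ^ 2 := by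
  set s : H := ∑ j, D.p j • v j with hs
  have h1 : ‖s‖ ^ 2 = ∑ j, D.p j * inner ℝ (D.B j (v j)) (D.B j s) := by
    rw [← real_inner_self_eq_norm_sq]
    nth_rewrite 1 [hs]
    rw [sum_inner]
    refine Finset.sum_congr rfl fun j _ => ?_
    rw [real_inner_smul_left]
    nth_rewrite 1 [← hv j]
    rw [ContinuousLinearMap.comp_apply, ContinuousLinearMap.adjoint_inner_left]
  have h2 : ‖s‖ ^ 2 ≤ ∑ j, D.p j * ((‖v j‖ ^ 2 + ‖D.B j s‖ ^ 2) / 2) := by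
    rw [h1]
    refine Finset.sum_le_sum fun j _ => mul_le_mul_of_nonneg_left ?_ (D.p_nonneg j)
    have a1 := real_inner_le_norm (D.B j (v j)) (D.B j s)
    have a2 := norm_apply_le_of_comp_adjoint_eq_id (hD.1 j) (v j)
    have a3 := mul_le_mul_of_nonneg_right a2 (norm_nonneg (D.B j s))
    nlinarith [sq_nonneg (‖v j‖ - ‖D.B j s‖)]
  have h3 : ∑ j, D.p j * ((‖v j‖ ^ 2 + ‖D.B j s‖ ^ 2) / 2) =
      (∑ j, D.p j * ‖v j‖ ^ 2 + ‖s‖ ^ 2) / 2 := by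
    rw [← hD.sum_mul_norm_sq s, ← Finset.sum_add_distrib, Finset.sum_div]
    exact Finset.sum_congr rfl fun j _ => by ring
  linarith

theorem Geometric.scaling {D : BLDatum H K} (hD : D.Geometric) : D.Scaling := by
  have h := congrArg (fun T : H →L[ℝ] H => LinearMap.trace ℝ H (T : H →ₗ[ℝ] H)) hD.2
  have hj : ∀ j, LinearMap.trace ℝ H
      ((ContinuousLinearMap.adjoint (D.B j) ∘L D.B j : H →L[ℝ] H) : H →ₗ[ℝ] H) =
      Module.finrank ℝ (K j) := by
    intro j
    rw [ContinuousLinearMap.toLinearMap_comp, LinearMap.trace_comp_comm',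
      ← ContinuousLinearMap.toLinearMap_comp, hD.1 j, ContinuousLinearMap.coe_id,
      LinearMap.trace_id]
  simp only [ContinuousLinearMap.toLinearMap_sum, ContinuousLinearMap.toLinearMap_smul, map_sum, map_smul, hj,
    ContinuousLinearMap.coe_id, LinearMap.trace_id, smul_eq_mul] at h
  exact h.symm

variable [MeasurableSpace H] [BorelSpace H] [∀ j, MeasurableSpace (K j)] [∀ j, BorelSpace (K j)]

theorem Geometric.lintegral_stdGaussian_smooth_le {D : BLDatum H K} (hD : D.Geometric)
    {f : ∀ j, K j → ℝ} (hc : ∀ j, HasCompactSupport (f j)) (hf : ∀ j, ContDiff ℝ 2 (f j))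
    (h0 : ∀ j y, 0 ≤ f j y) {c : ℝ} (hc0 : 0 < c) :
    ∫⁻ x, ∏ j, ENNReal.ofReal (f j (D.B j x) + c) ^ D.p j ∂(stdGaussian H) ≤
      ∏ j, (∫⁻ y, ENNReal.ofReal (f j y + c) ∂(stdGaussian (K j))) ^ D.p j := by
  choose L a hL using fun j => exists_smoothBounded_comp (hD.1 j) (hc j) (hf j) (h0 j) hc0
  obtain ⟨L', hL'⟩ : ∃ L', ∀ j, L j ≤ L' :=
    ⟨∑ j, |L j|, fun j => (le_abs_self _).trans
      (Finset.single_le_sum (f := fun j => |L j|) (fun j _ => abs_nonneg _) (Finset.mem_univ j))⟩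
  have hS := fun j => hL j L' (hL' j)
  have key := integral_prod_rpow_le_of_smoothBounded D.p_nonneg hD.norm_sum_sq_le hc0 hS
  have hpos : ∀ j x, 0 ≤ f j (D.B j x) + c := fun j x => add_nonneg (h0 _ _) hc0.le
  have hint : ∀ j, ENNReal.ofReal (∫ x, f j (D.B j x) + c ∂(stdGaussian H)) =
      ∫⁻ y, ENNReal.ofReal (f j y + c) ∂(stdGaussian (K j)) := by
    intro j
    have hi := (hS j).integrable hc0.le 1 0
    simp only [one_smul, zero_add] at hi
    rw [ofReal_integral_eq_lintegral_ofReal hi (.of_forall fun x => hpos j x),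
      ← map_stdGaussian_of_comp_adjoint_eq_id (hD.1 j), lintegral_map _ (by fun_prop)]
    exact ((hf j).continuous.measurable.add_const c).ennreal_ofReal
  have hcont : Continuous fun x => ∏ j, (f j (D.B j x) + c) ^ D.p j :=
    continuous_finsetProd _ fun j _ => (hS j).continuous.rpow_const fun x => .inr (D.p_nonneg j)
  have hprod0 : ∀ x, 0 ≤ ∏ j, (f j (D.B j x) + c) ^ D.p j := fun x =>
    Finset.prod_nonneg fun j _ => Real.rpow_nonneg (hpos j x) _
  have hi : Integrable (fun x => ∏ j, (f j (D.B j x) + c) ^ D.p j) (stdGaussian H) := by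
    refine Integrable.of_bound hcont.aestronglyMeasurable (∏ j, L' ^ D.p j)
      (.of_forall fun x => ?_)
    rw [Real.norm_of_nonneg (hprod0 x)]
    exact Finset.prod_le_prod (fun j _ => Real.rpow_nonneg (hpos j x) _) fun j _ =>
      Real.rpow_le_rpow (hpos j x) ((hS j).upper x) (D.p_nonneg j)
  have e1 : ∫⁻ x, ∏ j, ENNReal.ofReal (f j (D.B j x) + c) ^ D.p j ∂(stdGaussian H) =
      ENNReal.ofReal (∫ x, ∏ j, (f j (D.B j x) + c) ^ D.p j ∂(stdGaussian H)) := by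
    rw [ofReal_integral_eq_lintegral_ofReal hi (.of_forall hprod0)]
    refine lintegral_congr fun x => ?_
    rw [ENNReal.ofReal_prod_of_nonneg fun j _ => Real.rpow_nonneg (hpos j x) _]
    exact Finset.prod_congr rfl fun j _ =>
      ENNReal.ofReal_rpow_of_nonneg (hpos j x) (D.p_nonneg j)
  rw [e1]
  refine (ENNReal.ofReal_le_ofReal key).trans_eq ?_
  rw [ENNReal.ofReal_prod_of_nonneg fun j _ =>
    Real.rpow_nonneg (integral_nonneg fun x => hpos j x) _]
  refine Finset.prod_congr rfl fun j _ => ?_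
  rw [← hint, ENNReal.ofReal_rpow_of_nonneg (integral_nonneg fun x => hpos j x) (D.p_nonneg j)]

/-- Apply the smooth case to `φ² + ε`, where `ε` provides the positive lower bound. Fatou handles
the left side without domination, and the right side converges. -/
theorem Geometric.lintegral_stdGaussian_le {D : BLDatum H K} (hD : D.Geometric)
    {F : ∀ j, K j → ℝ≥0} (hF : ∀ j, Measurable (F j))
    (hfin : ∀ j, ∫⁻ y, (F j y : ℝ≥0∞) ∂(stdGaussian (K j)) < ∞) :
    ∫⁻ x, ∏ j, (F j (D.B j x) : ℝ≥0∞) ^ D.p j ∂(stdGaussian H) ≤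
      ∏ j, (∫⁻ y, (F j y : ℝ≥0∞) ∂(stdGaussian (K j))) ^ D.p j := by
  choose φ h1 h2 h3 using fun j => exists_smooth_sq_approx (stdGaussian (K j)) (hF j) (hfin j)
  set N : Fin m → ℝ≥0∞ := fun j => ∫⁻ y, (F j y : ℝ≥0∞) ∂(stdGaussian (K j)) with hN
  set ε : ℕ → ℝ := fun n => 1 / (n + 1 : ℝ) with hε
  have hε0 : ∀ n, 0 < ε n := fun n => by positivity
  have hεlim : Tendsto ε atTop (𝓝 0) := tendsto_one_div_add_atTop_nhds_zero_nat
  have hεlim' : Tendsto (fun n => ENNReal.ofReal (ε n)) atTop (𝓝 0) := by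
    simpa using ENNReal.tendsto_ofReal hεlim
  have hmeas : ∀ n j, Measurable fun x : H =>
      ENNReal.ofReal (φ j n (D.B j x) ^ 2 + ε n) ^ D.p j := fun n j => by
    have : Measurable (φ j n) := (h1 j n).2.continuous.measurable
    exact ((((this.comp (D.B j).continuous.measurable).pow_const 2).add_const
      _).ennreal_ofReal).pow_const _
  have step : ∀ n : ℕ, ∫⁻ x, ∏ j, ENNReal.ofReal (φ j n (D.B j x) ^ 2 + ε n) ^ D.p j
      ∂(stdGaussian H) ≤
      ∏ j, ((N j ^ (1 / 2 : ℝ) + ENNReal.ofReal (ε n)) ^ 2 + ENNReal.ofReal (ε n)) ^ D.p j := by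
    intro n
    refine (hD.lintegral_stdGaussian_smooth_le (f := fun j y => φ j n y ^ 2)
      (fun j => ?_) (fun j => (h1 j n).2.pow 2) (fun j y => sq_nonneg _) (hε0 n)).trans ?_
    · exact (h1 j n).1.comp_left (g := fun t : ℝ => t ^ 2) (by norm_num)
    · refine Finset.prod_le_prod' fun j _ => ENNReal.rpow_le_rpow ?_ (D.p_nonneg j)
      have : ∀ y, ENNReal.ofReal (φ j n y ^ 2 + ε n) =
          ENNReal.ofReal (φ j n y ^ 2) + ENNReal.ofReal (ε n) := fun y =>
        ENNReal.ofReal_add (sq_nonneg _) (hε0 n).le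
      simp_rw [this]
      rw [lintegral_add_right _ measurable_const, lintegral_const, measure_univ, mul_one]
      exact add_le_add (h3 j n) le_rfl
  -- Null sets pull back along `B j` because it carries the gaussian of `H` to that of `K j`.
  have hae : ∀ᵐ x ∂(stdGaussian H), ∀ j,
      Tendsto (fun n => φ j n (D.B j x) ^ 2) atTop (𝓝 (F j (D.B j x) : ℝ)) := by
    rw [ae_all_iff]
    intro j
    have := h2 j
    rw [← map_stdGaussian_of_comp_adjoint_eq_id (hD.1 j)] at this
    exact ae_of_ae_map (D.B j).continuous.aemeasurable this
  have hlim : ∀ᵐ x ∂(stdGaussian H), ∏ j, (F j (D.B j x) : ℝ≥0∞) ^ D.p j =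
      liminf (fun n => ∏ j, ENNReal.ofReal (φ j n (D.B j x) ^ 2 + ε n) ^ D.p j) atTop := by
    filter_upwards [hae] with x hx
    refine (Tendsto.liminf_eq ?_).symm
    refine ENNReal.tendsto_finsetProd_of_ne_top _ (fun j _ => ?_) fun j _ =>
      ENNReal.rpow_ne_top_of_nonneg (D.p_nonneg j) ENNReal.coe_ne_top
    have := ENNReal.tendsto_ofReal ((hx j).add hεlim)
    rw [add_zero, ENNReal.ofReal_coe_nnreal] at this
    exact this.ennrpow_const _
  rw [lintegral_congr_ae hlim]
  refine (lintegral_liminf_le fun n => Finset.measurable_prod _ fun j _ => hmeas n j).trans ?_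
  have hR : Tendsto (fun n => ∏ j, ((N j ^ (1 / 2 : ℝ) + ENNReal.ofReal (ε n)) ^ 2 +
      ENNReal.ofReal (ε n)) ^ D.p j) atTop (𝓝 (∏ j, N j ^ D.p j)) := by
    refine ENNReal.tendsto_finsetProd_of_ne_top _ (fun j _ => ?_) fun j _ =>
      ENNReal.rpow_ne_top_of_nonneg (D.p_nonneg j) (hfin j).ne
    refine Tendsto.ennrpow_const _ ?_
    have e : N j = (N j ^ (1 / 2 : ℝ) + 0) ^ 2 + 0 := by
      rw [add_zero, add_zero, ← ENNReal.rpow_natCast, ← ENNReal.rpow_mul]; norm_num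
    nth_rewrite 2 [e]
    exact (((ENNReal.continuous_pow 2).tendsto _).comp (hεlim'.const_add _)).add hεlim'
  calc liminf _ atTop ≤ liminf _ atTop := liminf_le_liminf (.of_forall step)
    _ = _ := hR.liminf_eq

/-- The geometric Brascamp--Lieb inequality. -/
theorem Geometric.lintegral_prod_le {D : BLDatum H K} (hD : D.Geometric)
    {f : ∀ j, K j → ℝ≥0} (hf : ∀ j, Measurable (f j)) (hfin : ∀ j, ∫⁻ y, (f j y : ℝ≥0∞) < ∞) :
    ∫⁻ x, ∏ j, (f j (D.B j x) : ℝ≥0∞) ^ D.p j ≤ ∏ j, (∫⁻ y, (f j y : ℝ≥0∞)) ^ D.p j := by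
  set ρ : ∀ j, K j → ℝ≥0 := fun j y => (gaussDensity y).toNNReal with hρ
  have hρ0 : ∀ j y, ρ j y ≠ 0 := fun j y => (Real.toNNReal_pos.2 (gaussDensity_pos y)).ne'
  have hρm : ∀ j, Measurable (ρ j) := fun j => continuous_gaussDensity.measurable.real_toNNReal
  set F : ∀ j, K j → ℝ≥0 := fun j y => f j y / ρ j y with hF
  have hFm : ∀ j, Measurable (F j) := fun j => (hf j).div (hρm j)
  have hmul : ∀ j y, (ρ j y : ℝ≥0∞) * F j y = f j y := by
    intro j y
    rw [← ENNReal.coe_mul, hF]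
    congr 1
    exact mul_div_cancel₀ _ (hρ0 j y)
  have hFint : ∀ j, ∫⁻ y, (F j y : ℝ≥0∞) ∂(stdGaussian (K j)) = ∫⁻ y, (f j y : ℝ≥0∞) := by
    intro j
    rw [lintegral_stdGaussian (hFm j).coe_nnreal_ennreal]
    exact lintegral_congr fun y => hmul j y
  -- The gaussian density factorises: the exponents match by `∑ p_j ‖B_j x‖² = ‖x‖²`, and the powers
  -- of `2π` by scaling. This is what cancels all weights when returning to Lebesgue measure.
  have hdens : ∀ x : H, ENNReal.ofReal (gaussDensity x) =
      ∏ j, (ρ j (D.B j x) : ℝ≥0∞) ^ D.p j := by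
    intro x
    have e : ∀ j, (ρ j (D.B j x) : ℝ≥0∞) ^ D.p j =
        ENNReal.ofReal (gaussDensity (D.B j x) ^ D.p j) := fun j =>
      ENNReal.ofReal_rpow_of_nonneg (gaussDensity_pos _).le (D.p_nonneg j)
    simp_rw [e]
    rw [← ENNReal.ofReal_prod_of_nonneg fun j _ => Real.rpow_nonneg (gaussDensity_pos _).le _]
    congr 1
    have hpi : 0 < 2 * Real.pi := by positivity
    have e2 : ∀ j, gaussDensity (D.B j x) ^ D.p j =
        (2 * Real.pi) ^ (-(D.p j * Module.finrank ℝ (K j)) / 2) *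
          Real.exp (-(D.p j * ‖D.B j x‖ ^ 2 / 2)) := by
      intro j
      rw [gaussDensity, Real.mul_rpow (by positivity) (by positivity), ← Real.rpow_mul hpi.le,
        ← Real.exp_mul]
      congr 2 <;> ring
    simp_rw [e2]
    rw [Finset.prod_mul_distrib, ← Real.exp_sum, ← Real.rpow_sum_of_pos hpi,
      ← Finset.sum_div, Finset.sum_neg_distrib, Finset.sum_neg_distrib, ← Finset.sum_div,
      hD.sum_mul_norm_sq, ← hD.scaling]
    rfl
  have key := hD.lintegral_stdGaussian_le hFm fun j => (hFint j).trans_lt (hfin j)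
  have hm : Measurable fun x : H => ∏ j, (F j (D.B j x) : ℝ≥0∞) ^ D.p j :=
    Finset.measurable_prod _ fun j _ =>
      ((hFm j).comp (D.B j).continuous.measurable).coe_nnreal_ennreal.pow_const _
  rw [lintegral_stdGaussian hm] at key
  simp_rw [hFint] at key
  refine le_trans (le_of_eq (lintegral_congr fun x => ?_)) key
  rw [hdens, ← Finset.prod_mul_distrib]
  refine Finset.prod_congr rfl fun j _ => ?_
  rw [← ENNReal.mul_rpow_of_nonneg _ _ (D.p_nonneg j), hmul]

end BLDatum

/-! ### Positive operators: traces, inverse square roots, determinants, gaussian integrals. -/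

section Operators

variable {E : Type*} [NormedAddCommGroup E] [InnerProductSpace ℝ E] [FiniteDimensional ℝ E]

theorem IsSelfAdjoint.inner_clm_left {T : E →L[ℝ] E} (hT : IsSelfAdjoint T) (x y : E) :
    inner ℝ (T x) y = inner ℝ x (T y) := by
  rw [← ContinuousLinearMap.adjoint_inner_right,
    ContinuousLinearMap.isSelfAdjoint_iff'.1 hT]

theorem ContinuousLinearMap.le_iff_inner_le {S T : E →L[ℝ] E} (hS : IsSelfAdjoint S)
    (hT : IsSelfAdjoint T) : S ≤ T ↔ ∀ x, inner ℝ (S x) x ≤ inner ℝ (T x) x := by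
  rw [ContinuousLinearMap.le_def, ContinuousLinearMap.isPositive_iff']
  simp [hT.sub hS, inner_sub_left]

theorem ContinuousLinearMap.IsPositive.eq_zero_of_trace_eq_zero {T : E →L[ℝ] E}
    (hT : T.IsPositive) (h : LinearMap.trace ℝ E (T : E →ₗ[ℝ] E) = 0) : T = 0 := by
  have hs := hT.isSymmetric
  set b := hs.eigenvectorBasis rfl with hb
  have hlam : ∀ i, inner ℝ (b i) (T (b i)) = hs.eigenvalues rfl i := by
    intro i
    have := hs.apply_eigenvectorBasis rfl i
    rw [← hb] at this
    have h2 : T (b i) = (hs.eigenvalues rfl i) • b i := this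
    rw [h2, real_inner_smul_right, real_inner_self_eq_norm_sq, b.norm_eq_one]
    simp
  rw [LinearMap.trace_eq_sum_inner _ b] at h
  replace h := (Finset.sum_eq_zero_iff_of_nonneg
    fun i _ => hT.inner_nonneg_right (b i)).1 h
  refine ContinuousLinearMap.coe_injective (b.toBasis.ext fun i => ?_)
  have h1 : hs.eigenvalues rfl i = 0 := (hlam i).symm.trans (h i (Finset.mem_univ i))
  have h2 := hs.apply_eigenvectorBasis rfl i
  rw [h1] at h2
  rw [b.coe_toBasis]
  exact h2.trans (by simp)

theorem IsSelfAdjoint.eq_zero_of_trace_comp_self {S : E →L[ℝ] E} (hS : IsSelfAdjoint S)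
    (h : LinearMap.trace ℝ E ((S ∘L S : E →L[ℝ] E) : E →ₗ[ℝ] E) = 0) : S = 0 := by
  have hpos : (S ∘L S).IsPositive := by
    have := ContinuousLinearMap.isPositive_adjoint_comp_self S
    rwa [ContinuousLinearMap.isSelfAdjoint_iff'.1 hS] at this
  have h0 := hpos.eq_zero_of_trace_eq_zero h
  ext x
  have h1 : inner ℝ (S x) (S x) = 0 := by
    rw [hS.inner_clm_left, ← ContinuousLinearMap.comp_apply, h0]
    simp
  simpa using h1

/-- A small functional calculus: on an eigenbasis it produces the square root, the inverse and their
products. -/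
theorem exists_diagonal (b : OrthonormalBasis (Fin (Module.finrank ℝ E)) ℝ E) :
    ∃ d : (Fin (Module.finrank ℝ E) → ℝ) → (E →L[ℝ] E),
      (∀ f i, d f (b i) = f i • b i) ∧ (∀ f, IsSelfAdjoint (d f)) ∧
      ∀ f x, inner ℝ (d f x) x = ∑ i, f i * (inner ℝ (b i) x) ^ 2 := by
  refine ⟨fun f => ∑ i, f i • InnerProductSpace.rankOne ℝ (b i) (b i), fun f i => ?_, fun f => ?_,
    fun f x => ?_⟩
  · simp [_root_.sum_apply, InnerProductSpace.rankOne_apply, b.inner_eq_ite]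
  · refine isSelfAdjoint_sum _ fun i _ => ?_
    exact (IsSelfAdjoint.all _).smul
      (InnerProductSpace.isPositive_rankOne_self (b i)).isSelfAdjoint
  · simp only [_root_.sum_apply, _root_.smul_apply, InnerProductSpace.rankOne_apply, sum_inner,
      real_inner_smul_left]
    exact Finset.sum_congr rfl fun i _ => by ring

theorem IsPosDefOp.exists_isInvSqrt {T : E →L[ℝ] E} (hT : IsPosDefOp T) :
    ∃ C : E ≃L[ℝ] E, IsInvSqrt (C : E →L[ℝ] E) T := by
  have hs : (T : E →ₗ[ℝ] E).IsSymmetric := fun x y => hT.1.inner_clm_left x y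
  set b := hs.eigenvectorBasis rfl with hb
  set lam := hs.eigenvalues rfl with hlam
  have hTb : ∀ i, T (b i) = lam i • b i := fun i => hs.apply_eigenvectorBasis rfl i
  have hpos : ∀ i, 0 < lam i := by
    intro i
    have hne : b i ≠ 0 := b.orthonormal.ne_zero i
    have := hT.2 (b i) hne
    rw [hTb, real_inner_smul_left, real_inner_self_eq_norm_sq, b.norm_eq_one] at this
    simpa using this
  obtain ⟨d, hd, hdsa, hdq⟩ := exists_diagonal b
  have hcomp : ∀ f g, d f ∘L d g = d (fun i => f i * g i) := by
    intro f g
    refine ContinuousLinearMap.coe_injective (b.toBasis.ext fun i => ?_)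
    simp [hd, smul_smul, mul_comm]
  have hone : d (fun _ => 1) = ContinuousLinearMap.id ℝ E := by
    refine ContinuousLinearMap.coe_injective (b.toBasis.ext fun i => ?_)
    simp [hd]
  have hTd : T = d lam := by
    refine ContinuousLinearMap.coe_injective (b.toBasis.ext fun i => ?_)
    simp [hd, hTb]
  set r : Fin (Module.finrank ℝ E) → ℝ := fun i => (√(lam i))⁻¹ with hr
  have hsq : ∀ i, √(lam i) * √(lam i) = lam i := fun i => Real.mul_self_sqrt (hpos i).le
  have hs0 : ∀ i, √(lam i) ≠ 0 := fun i => (Real.sqrt_pos.2 (hpos i)).ne'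
  have h1 : d r ∘L d (fun i => √(lam i)) = ContinuousLinearMap.id ℝ E := by
    rw [hcomp, ← hone]; congr 1; ext i; exact inv_mul_cancel₀ (hs0 i)
  have h2 : d (fun i => √(lam i)) ∘L d r = ContinuousLinearMap.id ℝ E := by
    rw [hcomp, ← hone]; congr 1; ext i; exact mul_inv_cancel₀ (hs0 i)
  refine ⟨ContinuousLinearEquiv.equivOfInverse (d r) (d fun i => √(lam i))
    (DFunLike.congr_fun h2) (DFunLike.congr_fun h1), ?_⟩
  have hC : ((ContinuousLinearEquiv.equivOfInverse (d r) (d fun i => √(lam i))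
    (DFunLike.congr_fun h2) (DFunLike.congr_fun h1) : E ≃L[ℝ] E) : E →L[ℝ] E) = d r := rfl
  have i1 : T * (d r ∘L d r) = 1 := by
    rw [ContinuousLinearMap.mul_def, hcomp, hTd, hcomp, ContinuousLinearMap.one_def, ← hone]
    congr 1; ext i
    have h3 := hsq i
    have h4 := hs0 i
    simp only [hr]
    field_simp
    rw [sq]; exact h3.symm
  have i2 : (d r ∘L d r) * T = 1 := by
    rw [ContinuousLinearMap.mul_def, hcomp, hTd, hcomp, ContinuousLinearMap.one_def, ← hone]
    congr 1; ext i
    have h3 := hsq i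
    have h4 := hs0 i
    simp only [hr]
    field_simp
    rw [sq]; exact h3.symm
  rw [hC]
  refine ⟨⟨⟨T, d r ∘L d r, i1, i2⟩, rfl⟩, ⟨hdsa r, fun x hx => ?_⟩, ?_⟩
  · rw [hdq]
    have hx' : ∃ i, inner ℝ (b i) x ≠ 0 := by
      by_contra! h
      have h0 := b.sum_sq_inner_right x
      simp only [h] at h0
      simp at h0
      exact hx (by simpa using h0.symm)
    obtain ⟨i, hi⟩ := hx'
    have hr0 : ∀ i, 0 < r i := fun i => inv_pos.2 (Real.sqrt_pos.2 (hpos i))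
    refine Finset.sum_pos' (fun i _ => mul_nonneg (hr0 i).le (sq_nonneg _)) ⟨i,
      Finset.mem_univ i, ?_⟩
    have := hr0 i
    positivity
  · exact (Ring.inverse_unit (⟨T, d r ∘L d r, i1, i2⟩ : (E →L[ℝ] E)ˣ)).symm

namespace IsInvSqrt

variable {T : E →L[ℝ] E} {C : E ≃L[ℝ] E}

theorem adjoint_eq (h : IsInvSqrt (C : E →L[ℝ] E) T) :
    ContinuousLinearMap.adjoint (C : E →L[ℝ] E) = C :=
  ContinuousLinearMap.isSelfAdjoint_iff'.1 h.2.1.1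

theorem inner_left (h : IsInvSqrt (C : E →L[ℝ] E) T) (x y : E) :
    inner ℝ (C x) y = inner ℝ x (C y) :=
  h.2.1.1.inner_clm_left x y

theorem inner_symm_left (h : IsInvSqrt (C : E →L[ℝ] E) T) (x y : E) :
    inner ℝ (C.symm x) y = inner ℝ x (C.symm y) := by
  have := h.inner_left (C.symm x) (C.symm y)
  rw [C.apply_symm_apply, C.apply_symm_apply] at this
  exact this.symm

theorem inverse_apply (h : IsInvSqrt (C : E →L[ℝ] E) T) (x : E) :
    Ring.inverse T x = C (C x) := by
  rw [← h.2.2]; rfl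

theorem apply_eq (h : IsInvSqrt (C : E →L[ℝ] E) T) (x : E) : T x = C.symm (C.symm x) := by
  have h1 := DFunLike.congr_fun (Ring.inverse_mul_cancel T h.1) x
  rw [mul_apply_eq_comp, h.inverse_apply, one_apply_eq_self] at h1
  apply C.injective
  apply C.injective
  rw [h1, C.apply_symm_apply, C.apply_symm_apply]

theorem isSelfAdjoint_inverse (h : IsInvSqrt (C : E →L[ℝ] E) T) :
    IsSelfAdjoint (Ring.inverse T) := by
  rw [ContinuousLinearMap.isSelfAdjoint_iff', ← h.2.2, ContinuousLinearMap.adjoint_comp,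
    h.adjoint_eq]

theorem det_mul_sq (h : IsInvSqrt (C : E →L[ℝ] E) T) :
    T.det * (C : E →L[ℝ] E).det ^ 2 = 1 := by
  have h1 := congrArg (fun S : E →L[ℝ] E => LinearMap.det (S : E →ₗ[ℝ] E))
    (Ring.mul_inverse_cancel T h.1)
  rw [← h.2.2] at h1
  have h2 : ((T * ((C : E →L[ℝ] E) ∘L (C : E →L[ℝ] E)) : E →L[ℝ] E) : E →ₗ[ℝ] E) =
    (T : E →ₗ[ℝ] E) * (((C : E →L[ℝ] E) : E →ₗ[ℝ] E) * ((C : E →L[ℝ] E) : E →ₗ[ℝ] E)) := rfl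
  have h3 : ((1 : E →L[ℝ] E) : E →ₗ[ℝ] E) = 1 := rfl
  simp only [h2, h3, map_mul, map_one] at h1
  rw [sq]
  exact h1

theorem det_pos (h : IsInvSqrt (C : E →L[ℝ] E) T) : 0 < T.det := by
  have h1 := h.det_mul_sq
  by_contra! h2
  nlinarith [sq_nonneg (C : E →L[ℝ] E).det]

theorem abs_det (h : IsInvSqrt (C : E →L[ℝ] E) T) :
    |(C : E →L[ℝ] E).det| = T.det ^ (-(1 / 2) : ℝ) := by
  have h1 := h.det_mul_sq
  have h2 := h.det_pos
  rw [Real.rpow_neg h2.le, ← Real.sqrt_eq_rpow, ← Real.sqrt_inv, ← Real.sqrt_sq_eq_abs]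
  congr 1
  exact eq_inv_of_mul_eq_one_right h1

end IsInvSqrt

theorem IsPosDefOp.det_pos {T : E →L[ℝ] E} (hT : IsPosDefOp T) : 0 < T.det :=
  hT.exists_isInvSqrt.choose_spec.det_pos

theorem IsPosDefOp.isUnit {T : E →L[ℝ] E} (hT : IsPosDefOp T) : IsUnit T :=
  hT.exists_isInvSqrt.choose_spec.1

theorem ContinuousLinearMap.isUnit_of_det_ne_zero {T : E →L[ℝ] E} (h : T.det ≠ 0) : IsUnit T := by
  have h1 : IsUnit (T : E →ₗ[ℝ] E) := (LinearMap.isUnit_iff_isUnit_det _).2 h.isUnit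
  obtain ⟨u, hu⟩ := h1
  refine ⟨⟨T, LinearMap.toContinuousLinearMap (↑u⁻¹ : E →ₗ[ℝ] E), ?_, ?_⟩, rfl⟩
  · refine ContinuousLinearMap.coe_injective ?_
    have : (T : E →ₗ[ℝ] E) * (↑u⁻¹ : E →ₗ[ℝ] E) = 1 := by rw [← hu]; simp
    exact this
  · refine ContinuousLinearMap.coe_injective ?_
    have : (↑u⁻¹ : E →ₗ[ℝ] E) * (T : E →ₗ[ℝ] E) = 1 := by rw [← hu]; simp
    exact this

/-- With `C = T^(-1/2)`, the form of `T` at `x` is `‖C⁻¹ x‖²`, and the perturbation is at most `|t|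
‖S‖ ‖C‖²` times that. -/
theorem IsPosDefOp.eventually_add_smul {T S : E →L[ℝ] E} (hT : IsPosDefOp T)
    (hS : IsSelfAdjoint S) : ∀ᶠ t : ℝ in 𝓝 0, IsPosDefOp (T + t • S) := by
  obtain ⟨C, hC⟩ := hT.exists_isInvSqrt
  have hlim : Tendsto (fun t : ℝ => |t| * ‖S‖ * ‖(C : E →L[ℝ] E)‖ ^ 2) (𝓝 0)
      (𝓝 (|(0 : ℝ)| * ‖S‖ * ‖(C : E →L[ℝ] E)‖ ^ 2)) := by
    apply Continuous.tendsto; fun_prop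
  rw [abs_zero, zero_mul, zero_mul] at hlim
  filter_upwards [hlim.eventually (gt_mem_nhds one_pos)] with t ht
  refine ⟨hT.1.add ((IsSelfAdjoint.all t).smul hS), fun x hx => ?_⟩
  have hy : 0 < ‖C.symm x‖ := norm_pos_iff.2 (by simpa using hx)
  have h1 : inner ℝ (T x) x = ‖C.symm x‖ ^ 2 := by
    rw [hC.apply_eq, hC.inner_symm_left, real_inner_self_eq_norm_sq]
  have h2 : ‖x‖ ≤ ‖(C : E →L[ℝ] E)‖ * ‖C.symm x‖ := by
    have := (C : E →L[ℝ] E).le_opNorm (C.symm x)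
    simpa using this
  have h3 : |inner ℝ ((t • S) x) x| ≤ |t| * ‖S‖ * ‖(C : E →L[ℝ] E)‖ ^ 2 * ‖C.symm x‖ ^ 2 := by
    calc |inner ℝ ((t • S) x) x| ≤ ‖(t • S) x‖ * ‖x‖ := abs_real_inner_le_norm _ _
      _ ≤ (|t| * ‖S‖ * ‖x‖) * ‖x‖ := by
          gcongr
          rw [_root_.smul_apply, norm_smul, Real.norm_eq_abs, mul_assoc]
          gcongr
          exact S.le_opNorm x
      _ = |t| * ‖S‖ * ‖x‖ ^ 2 := by ring
      _ ≤ |t| * ‖S‖ * (‖(C : E →L[ℝ] E)‖ * ‖C.symm x‖) ^ 2 := by gcongr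
      _ = _ := by ring
  have h4 := (abs_le.1 h3).1
  rw [_root_.add_apply, inner_add_left, h1]
  nlinarith [mul_pos hy hy]

/-- In a basis, `det (1 + t X)` is a polynomial in `t` with constant term `1` and linear coefficient
the trace. -/
theorem hasDerivAt_det_one_add_smul (X : E →L[ℝ] E) :
    HasDerivAt (fun t : ℝ => (1 + t • X).det) (LinearMap.trace ℝ E (X : E →ₗ[ℝ] E)) 0 := by
  classical
  set b := Module.finBasis ℝ E
  set M := LinearMap.toMatrix b b (X : E →ₗ[ℝ] E) with hM
  have e : ∀ t : ℝ, (1 + t • X).det = 1 + M.trace * t +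
      Polynomial.eval t (1 + (Polynomial.X : Polynomial ℝ) • M.map Polynomial.C).det.divX.divX *
        t ^ 2 := by
    intro t
    rw [← Matrix.det_one_add_smul, ContinuousLinearMap.det, ← LinearMap.det_toMatrix b]
    congr 1
    have : ((1 + t • X : E →L[ℝ] E) : E →ₗ[ℝ] E) = LinearMap.id + t • (X : E →ₗ[ℝ] E) := rfl
    rw [this, map_add, map_smul, LinearMap.toMatrix_id]
  simp_rw [e]
  have htr : LinearMap.trace ℝ E (X : E →ₗ[ℝ] E) = M.trace := by
    rw [hM, LinearMap.trace_eq_matrix_trace ℝ b]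
  set q := (1 + (Polynomial.X : Polynomial ℝ) • M.map Polynomial.C).det.divX.divX
  have h := (((hasDerivAt_id (0 : ℝ)).const_mul M.trace).const_add 1).add
    ((q.hasDerivAt 0).mul ((hasDerivAt_id (0 : ℝ)).pow 2))
  rw [htr]
  convert! h using 1
  simp

section Measure

variable [MeasurableSpace E] [BorelSpace E]

theorem lintegral_eq_det_mul_lintegral_comp (C : E ≃L[ℝ] E) (f : E → ℝ≥0∞) :
    ∫⁻ x, f x = ENNReal.ofReal |(C : E →L[ℝ] E).det| * ∫⁻ x, f (C x) := by
  have hdet : LinearMap.det ((C : E →L[ℝ] E) : E →ₗ[ℝ] E) ≠ 0 :=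
    (LinearEquiv.isUnit_det' C.toLinearEquiv).ne_zero
  have h1 : (volume : Measure E).map C = ENNReal.ofReal |((C : E →L[ℝ] E).det)⁻¹| • volume :=
    Measure.map_linearMap_addHaar_eq_smul_addHaar volume hdet
  have h2 : ∫⁻ x, f (C x) = ∫⁻ y, f y ∂((volume : Measure E).map C) :=
    (lintegral_map_equiv f C.toHomeomorph.toMeasurableEquiv).symm
  rw [h2, h1, lintegral_smul_measure, smul_eq_mul, ← mul_assoc,
    ← ENNReal.ofReal_mul (abs_nonneg _), ← abs_mul, mul_inv_cancel₀ hdet]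
  simp

theorem IsPosDefOp.lintegral_gaussian {T : E →L[ℝ] E} (hT : IsPosDefOp T) :
    ∫⁻ x, ENNReal.ofReal (Real.exp (-Real.pi * inner ℝ (T x) x)) =
      ENNReal.ofReal (T.det ^ (-(1 / 2) : ℝ)) := by
  obtain ⟨C, hC⟩ := hT.exists_isInvSqrt
  rw [lintegral_eq_det_mul_lintegral_comp C, hC.abs_det]
  have e : ∀ x, inner ℝ (T (C x)) (C x) = ‖x‖ ^ 2 := by
    intro x
    rw [hC.apply_eq, C.symm_apply_apply, hC.inner_symm_left, C.symm_apply_apply,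
      real_inner_self_eq_norm_sq]
  simp_rw [e]
  have h1 := GaussianFourier.integral_rexp_neg_mul_sq_norm (V := E) Real.pi_pos
  rw [div_self Real.pi_ne_zero, Real.one_rpow] at h1
  -- A non-integrable function would have integral `0` by convention, but this integral is `1`.
  have hi : Integrable fun x : E => Real.exp (-Real.pi * ‖x‖ ^ 2) := by
    by_contra h
    rw [integral_undef h] at h1
    exact zero_ne_one h1
  rw [← ofReal_integral_eq_lintegral_ofReal hi (.of_forall fun x => (Real.exp_pos _).le), h1]
  simp

end Measure

end Operators

/-! ### Conjugation by inverse square roots, and conditions (c)–(e) for the conjugated datum. -/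

namespace BLDatum

section Algebra

variable {m : ℕ} {H : Type*} [NormedAddCommGroup H] [InnerProductSpace ℝ H]
  [FiniteDimensional ℝ H] {K : Fin m → Type*}
  [∀ j, NormedAddCommGroup (K j)] [∀ j, InnerProductSpace ℝ (K j)]
  [∀ j, FiniteDimensional ℝ (K j)] {D : BLDatum H K} {A : ∀ j, K j →L[ℝ] K j}

theorem inner_opM (D : BLDatum H K) (A : ∀ j, K j →L[ℝ] K j) (x : H) :
    inner ℝ (D.opM A x) x = ∑ j, D.p j * inner ℝ (A j (D.B j x)) (D.B j x) := by
  simp only [opM, _root_.sum_apply, _root_.smul_apply, sum_inner, real_inner_smul_left,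
    ContinuousLinearMap.comp_apply, ContinuousLinearMap.adjoint_inner_left]

theorem isSelfAdjoint_adjoint_comp_comp {E F : Type*} [NormedAddCommGroup E]
    [InnerProductSpace ℝ E] [FiniteDimensional ℝ E] [NormedAddCommGroup F]
    [InnerProductSpace ℝ F] [FiniteDimensional ℝ F] (B : E →L[ℝ] F) {T : F →L[ℝ] F}
    (hT : IsSelfAdjoint T) : IsSelfAdjoint (ContinuousLinearMap.adjoint B ∘L T ∘L B) := by
  rw [ContinuousLinearMap.isSelfAdjoint_iff'] at hT ⊢
  rw [ContinuousLinearMap.adjoint_comp, ContinuousLinearMap.adjoint_comp,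
    ContinuousLinearMap.adjoint_adjoint, hT, ContinuousLinearMap.comp_assoc]

theorem isSelfAdjoint_opM (D : BLDatum H K) (hA : IsGaussianInput A) :
    IsSelfAdjoint (D.opM A) :=
  isSelfAdjoint_sum _ fun j _ =>
    (IsSelfAdjoint.all _).smul (isSelfAdjoint_adjoint_comp_comp _ (hA j).1)

theorem isPosDefOp_opM_of_ker (hp : ∀ j, 0 < D.p j) (hA : IsGaussianInput A)
    (hk : ∀ x : H, (∀ j, D.B j x = 0) → x = 0) : IsPosDefOp (D.opM A) := by
  refine ⟨D.isSelfAdjoint_opM hA, fun x hx => ?_⟩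
  obtain ⟨j, hj⟩ : ∃ j, D.B j x ≠ 0 := by
    by_contra! h
    exact hx (hk x h)
  rw [inner_opM]
  refine Finset.sum_pos' (fun i _ => mul_nonneg (hp i).le ?_)
    ⟨j, Finset.mem_univ j, mul_pos (hp j) ((hA j).2 _ hj)⟩
  rcases eq_or_ne (D.B i x) 0 with h | h
  · simp [h]
  · exact ((hA i).2 _ h).le

theorem ker_of_isUnit_opM (h : IsUnit (D.opM A)) (x : H) (hx : ∀ j, D.B j x = 0) : x = 0 := by
  have h0 : D.opM A x = 0 := by
    simp [opM, _root_.sum_apply, hx]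
  have h1 := DFunLike.congr_fun (Ring.inverse_mul_cancel _ h) x
  rw [mul_apply_eq_comp, h0, map_zero, one_apply_eq_self] at h1
  exact h1.symm

/-- The datum `B' j = (Cj j)⁻¹ (B j) C`. -/
noncomputable def conj (D : BLDatum H K) (C : H ≃L[ℝ] H) (Cj : ∀ j, K j ≃L[ℝ] K j) :
    BLDatum H K where
  B j := ((Cj j).symm : K j →L[ℝ] K j) ∘L D.B j ∘L (C : H →L[ℝ] H)
  p := D.p
  p_nonneg := D.p_nonneg

variable {C : H ≃L[ℝ] H} {Cj : ∀ j, K j ≃L[ℝ] K j}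

omit [FiniteDimensional ℝ H] [∀ j, FiniteDimensional ℝ (K j)] in
theorem equivalentVia_conj (D : BLDatum H K) (C : H ≃L[ℝ] H) (Cj : ∀ j, K j ≃L[ℝ] K j) :
    D.EquivalentVia (D.conj C Cj) C Cj :=
  ⟨rfl, fun _ => rfl⟩

omit [FiniteDimensional ℝ H] [∀ j, FiniteDimensional ℝ (K j)] in
theorem EquivalentVia.eq_conj {D' : BLDatum H K} (h : D.EquivalentVia D' C Cj) :
    D' = D.conj C Cj := by
  cases D'
  obtain ⟨h1, h2⟩ := h
  simp only at h1 h2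
  subst h1
  simp only [conj, BLDatum.mk.injEq, and_true]
  exact funext h2

theorem adjoint_conj_apply (hC : IsInvSqrt (C : H →L[ℝ] H) (D.opM A))
    (hCj : ∀ j, IsInvSqrt (Cj j : K j →L[ℝ] K j) (A j)) (j : Fin m) (y : K j) :
    ContinuousLinearMap.adjoint ((D.conj C Cj).B j) y =
      C (ContinuousLinearMap.adjoint (D.B j) ((Cj j).symm y)) := by
  refine ext_inner_right ℝ fun x => ?_
  rw [ContinuousLinearMap.adjoint_inner_left, hC.inner_left,
    ContinuousLinearMap.adjoint_inner_left, (hCj j).inner_symm_left]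
  rfl

/-- For the conjugated map, `B' B'* = A_j^(1/2) (B_j M⁻¹ B_j*) A_j^(1/2)`; cancel the outer factors.
-/
theorem conj_comp_adjoint_eq_id_iff (hC : IsInvSqrt (C : H →L[ℝ] H) (D.opM A))
    (hCj : ∀ j, IsInvSqrt (Cj j : K j →L[ℝ] K j) (A j)) (j : Fin m) :
    (D.conj C Cj).B j ∘L ContinuousLinearMap.adjoint ((D.conj C Cj).B j) =
        ContinuousLinearMap.id ℝ (K j) ↔
      Ring.inverse (A j) -
        D.B j ∘L Ring.inverse (D.opM A) ∘L ContinuousLinearMap.adjoint (D.B j) = 0 := by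
  rw [sub_eq_zero]
  have e : ∀ y, (D.conj C Cj).B j (ContinuousLinearMap.adjoint ((D.conj C Cj).B j) y) =
      (Cj j).symm (D.B j (C (C (ContinuousLinearMap.adjoint (D.B j) ((Cj j).symm y))))) := by
    intro y
    rw [adjoint_conj_apply hC hCj]
    rfl
  constructor
  · intro h
    ext y
    have h1 := DFunLike.congr_fun h ((Cj j) y)
    rw [ContinuousLinearMap.comp_apply, e, ContinuousLinearMap.id_apply,
      (Cj j).symm_apply_apply] at h1
    rw [(hCj j).inverse_apply, ContinuousLinearMap.comp_apply, ContinuousLinearMap.comp_apply,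
      hC.inverse_apply, ← (Cj j).symm_apply_eq.1 h1]
  · intro h
    ext y
    have h1 := DFunLike.congr_fun h ((Cj j).symm y)
    rw [(hCj j).inverse_apply, ContinuousLinearMap.comp_apply, ContinuousLinearMap.comp_apply,
      hC.inverse_apply, (Cj j).apply_symm_apply] at h1
    rw [ContinuousLinearMap.comp_apply, e, ContinuousLinearMap.id_apply, ← h1,
      (Cj j).symm_apply_apply]

/-- The sum is `M^(-1/2) M M^(-1/2)`, so this half of geometricity comes for free. -/
theorem sum_conj_eq_id (hC : IsInvSqrt (C : H →L[ℝ] H) (D.opM A))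
    (hCj : ∀ j, IsInvSqrt (Cj j : K j →L[ℝ] K j) (A j)) :
    ∑ j, (D.conj C Cj).p j • (ContinuousLinearMap.adjoint ((D.conj C Cj).B j) ∘L
      (D.conj C Cj).B j) = ContinuousLinearMap.id ℝ H := by
  ext x
  have h1 : ∀ j, ContinuousLinearMap.adjoint ((D.conj C Cj).B j) ((D.conj C Cj).B j x) =
      C (ContinuousLinearMap.adjoint (D.B j) (A j (D.B j (C x)))) := by
    intro j
    rw [adjoint_conj_apply hC hCj, (hCj j).apply_eq]
    rfl
  have h2 : C (D.opM A (C x)) = x := by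
    rw [hC.apply_eq, C.symm_apply_apply, C.apply_symm_apply]
  rw [opM, _root_.sum_apply, map_sum] at h2
  simp only [_root_.sum_apply, _root_.smul_apply, ContinuousLinearMap.comp_apply, h1,
    ContinuousLinearMap.id_apply]
  simp only [_root_.smul_apply, ContinuousLinearMap.comp_apply, map_smul] at h2
  exact h2

theorem geometric_conj_iff (hC : IsInvSqrt (C : H →L[ℝ] H) (D.opM A))
    (hCj : ∀ j, IsInvSqrt (Cj j : K j →L[ℝ] K j) (A j)) :
    (D.conj C Cj).Geometric ↔ ∀ j, Ring.inverse (A j) -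
      D.B j ∘L Ring.inverse (D.opM A) ∘L ContinuousLinearMap.adjoint (D.B j) = 0 := by
  rw [Geometric, and_iff_left (sum_conj_eq_id hC hCj)]
  exact forall_congr' (conj_comp_adjoint_eq_id_iff hC hCj)

omit [FiniteDimensional ℝ H] in
theorem norm_conj_apply_sq (hCj : ∀ j, IsInvSqrt (Cj j : K j →L[ℝ] K j) (A j)) (j : Fin m)
    (x : H) : ‖(D.conj C Cj).B j x‖ ^ 2 = inner ℝ (A j (D.B j (C x))) (D.B j (C x)) := by
  rw [(hCj j).apply_eq, (hCj j).inner_symm_left, real_inner_self_eq_norm_sq]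
  rfl

theorem adjoint_comp_comp_le_opM_iff (hA : IsGaussianInput A)
    (hC : IsInvSqrt (C : H →L[ℝ] H) (D.opM A))
    (hCj : ∀ j, IsInvSqrt (Cj j : K j →L[ℝ] K j) (A j)) (j : Fin m) :
    ContinuousLinearMap.adjoint (D.B j) ∘L A j ∘L D.B j ≤ D.opM A ↔
      ∀ x, ‖(D.conj C Cj).B j x‖ ≤ ‖x‖ := by
  rw [ContinuousLinearMap.le_iff_inner_le (isSelfAdjoint_adjoint_comp_comp _ (hA j).1)
    (D.isSelfAdjoint_opM hA)]
  have h1 : ∀ x, inner ℝ (D.opM A (C x)) (C x) = ‖x‖ ^ 2 := by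
    intro x
    rw [hC.apply_eq, hC.inner_symm_left, C.symm_apply_apply, real_inner_self_eq_norm_sq]
  simp only [ContinuousLinearMap.comp_apply, ContinuousLinearMap.adjoint_inner_left]
  constructor
  · intro h x
    have := h (C x)
    rw [h1, ← norm_conj_apply_sq hCj] at this
    exact (pow_le_pow_iff_left₀ (norm_nonneg _) (norm_nonneg _) two_ne_zero).1 this
  · intro h x
    obtain ⟨z, rfl⟩ := C.surjective x
    rw [h1, ← norm_conj_apply_sq hCj]
    exact pow_le_pow_left₀ (norm_nonneg _) (h z) 2

theorem comp_inverse_comp_adjoint_le_iff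
    (hC : IsInvSqrt (C : H →L[ℝ] H) (D.opM A))
    (hCj : ∀ j, IsInvSqrt (Cj j : K j →L[ℝ] K j) (A j)) (j : Fin m) :
    D.B j ∘L Ring.inverse (D.opM A) ∘L ContinuousLinearMap.adjoint (D.B j) ≤
        Ring.inverse (A j) ↔
      ∀ y, ‖ContinuousLinearMap.adjoint ((D.conj C Cj).B j) y‖ ≤ ‖y‖ := by
  have hs : IsSelfAdjoint
      (D.B j ∘L Ring.inverse (D.opM A) ∘L ContinuousLinearMap.adjoint (D.B j)) := by
    have := isSelfAdjoint_adjoint_comp_comp (ContinuousLinearMap.adjoint (D.B j))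
      hC.isSelfAdjoint_inverse
    rwa [ContinuousLinearMap.adjoint_adjoint] at this
  rw [ContinuousLinearMap.le_iff_inner_le hs (hCj j).isSelfAdjoint_inverse]
  have h1 : ∀ y, inner ℝ (Ring.inverse (A j) ((Cj j).symm y)) ((Cj j).symm y) = ‖y‖ ^ 2 := by
    intro y
    rw [(hCj j).inverse_apply, (hCj j).inner_left, (Cj j).apply_symm_apply,
      real_inner_self_eq_norm_sq]
  have h2 : ∀ y, inner ℝ ((D.B j ∘L Ring.inverse (D.opM A) ∘L
      ContinuousLinearMap.adjoint (D.B j)) ((Cj j).symm y)) ((Cj j).symm y) =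
      ‖ContinuousLinearMap.adjoint ((D.conj C Cj).B j) y‖ ^ 2 := by
    intro y
    rw [adjoint_conj_apply hC hCj, ContinuousLinearMap.comp_apply,
      ContinuousLinearMap.comp_apply, hC.inverse_apply,
      ← ContinuousLinearMap.adjoint_inner_right, hC.inner_left, real_inner_self_eq_norm_sq]
  constructor
  · intro h y
    have := h ((Cj j).symm y)
    rw [h1, h2] at this
    exact (pow_le_pow_iff_left₀ (norm_nonneg _) (norm_nonneg _) two_ne_zero).1 this
  · intro h y
    obtain ⟨z, rfl⟩ := (Cj j).symm.surjective y
    rw [h1, h2]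
    exact pow_le_pow_left₀ (norm_nonneg _) (h z) 2

theorem _root_.ContinuousLinearMap.forall_norm_le_iff {E F : Type*} [NormedAddCommGroup E]
    [NormedSpace ℝ E] [NormedAddCommGroup F] [NormedSpace ℝ F] (T : E →L[ℝ] F) :
    (∀ x, ‖T x‖ ≤ ‖x‖) ↔ ‖T‖ ≤ 1 := by
  rw [ContinuousLinearMap.opNorm_le_iff zero_le_one]
  simp

theorem norm_adjoint_apply_le_iff {E F : Type*} [NormedAddCommGroup E] [InnerProductSpace ℝ E]
    [FiniteDimensional ℝ E] [NormedAddCommGroup F] [InnerProductSpace ℝ F]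
    [FiniteDimensional ℝ F] (T : E →L[ℝ] F) :
    (∀ y, ‖ContinuousLinearMap.adjoint T y‖ ≤ ‖y‖) ↔ ∀ x, ‖T x‖ ≤ ‖x‖ := by
  rw [ContinuousLinearMap.forall_norm_le_iff, ContinuousLinearMap.forall_norm_le_iff,
    LinearIsometryEquiv.norm_map]

/-- The defects `id - B_j B_j*` are positive, and their `p_j`-weighted traces sum to `∑ p_j dim K_j
- dim H = 0`. As `p_j > 0`, each trace, hence each defect, is zero. -/
theorem comp_adjoint_eq_id_of_norm_le {D : BLDatum H K} (hp : ∀ j, 0 < D.p j) (hs : D.Scaling)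
    (hsum : ∑ j, D.p j • (ContinuousLinearMap.adjoint (D.B j) ∘L D.B j) =
      ContinuousLinearMap.id ℝ H)
    (hle : ∀ j y, ‖ContinuousLinearMap.adjoint (D.B j) y‖ ≤ ‖y‖) (j : Fin m) :
    D.B j ∘L ContinuousLinearMap.adjoint (D.B j) = ContinuousLinearMap.id ℝ (K j) := by
  set S : ∀ j, K j →L[ℝ] K j := fun j =>
    ContinuousLinearMap.id ℝ (K j) - D.B j ∘L ContinuousLinearMap.adjoint (D.B j) with hS
  have hpos : ∀ j, (S j).IsPositive := by
    intro j
    rw [hS, ← ContinuousLinearMap.le_def, ContinuousLinearMap.le_iff_inner_le]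
    · intro y
      rw [ContinuousLinearMap.comp_apply, ← ContinuousLinearMap.adjoint_inner_right,
        real_inner_self_eq_norm_sq, ContinuousLinearMap.id_apply, real_inner_self_eq_norm_sq]
      exact pow_le_pow_left₀ (norm_nonneg _) (hle j y) 2
    · exact (ContinuousLinearMap.isPositive_self_comp_adjoint _).isSelfAdjoint
    · exact ContinuousLinearMap.isPositive_id.isSelfAdjoint
  have htr : ∀ j, LinearMap.trace ℝ (K j) (S j : K j →ₗ[ℝ] K j) = Module.finrank ℝ (K j) -
      LinearMap.trace ℝ H
        ((ContinuousLinearMap.adjoint (D.B j) ∘L D.B j : H →L[ℝ] H) : H →ₗ[ℝ] H) := by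
    intro j
    rw [ContinuousLinearMap.toLinearMap_comp, LinearMap.trace_comp_comm',
      ← ContinuousLinearMap.toLinearMap_comp, hS, ContinuousLinearMap.toLinearMap_sub, map_sub,
      ContinuousLinearMap.coe_id, LinearMap.trace_id]
  have h := congrArg (fun T : H →L[ℝ] H => LinearMap.trace ℝ H (T : H →ₗ[ℝ] H)) hsum
  simp only [ContinuousLinearMap.toLinearMap_sum, ContinuousLinearMap.toLinearMap_smul, map_sum,
    map_smul, ContinuousLinearMap.coe_id, LinearMap.trace_id, smul_eq_mul] at h
  have hz : ∑ j, D.p j * LinearMap.trace ℝ (K j) (S j : K j →ₗ[ℝ] K j) = 0 := by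
    simp_rw [htr, mul_sub]
    rw [Finset.sum_sub_distrib, h, ← hs, sub_self]
  have hnn : ∀ j, 0 ≤ LinearMap.trace ℝ (K j) (S j : K j →ₗ[ℝ] K j) := fun j =>
    ((ContinuousLinearMap.isPositive_toLinearMap_iff _).2 (hpos j)).trace_nonneg
  rw [Finset.sum_eq_zero_iff_of_nonneg fun j _ => mul_nonneg (hp j).le (hnn j)] at hz
  have h0 := (mul_eq_zero.1 (hz j (Finset.mem_univ j))).resolve_left (hp j).ne'
  exact (sub_eq_zero.1 ((hpos j).eq_zero_of_trace_eq_zero h0)).symm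

theorem gaussBLAt_eq_ofReal (hA : IsGaussianInput A) (hM : IsPosDefOp (D.opM A)) :
    D.gaussBLAt A =
      ENNReal.ofReal (((∏ j, (A j).det ^ D.p j) / (D.opM A).det) ^ (1 / 2 : ℝ)) := by
  have h0 : ∀ j, 0 ≤ (A j).det ^ D.p j := fun j => Real.rpow_nonneg (hA j).det_pos.le _
  rw [gaussBLAt, ← ENNReal.ofReal_rpow_of_nonneg (div_nonneg (Finset.prod_nonneg fun j _ => h0 j)
    hM.det_pos.le) (by norm_num), ENNReal.ofReal_div_of_pos hM.det_pos,
    ENNReal.ofReal_prod_of_nonneg fun j _ => h0 j]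
  congr 2
  exact Finset.prod_congr rfl fun j _ =>
    ENNReal.ofReal_rpow_of_nonneg (hA j).det_pos.le (D.p_nonneg j)

/-- Each factor is the integral of a gaussian, so this is the form that can be compared with `blAt`.
-/
theorem gaussBLAt_eq_div (hA : IsGaussianInput A) (hM : IsPosDefOp (D.opM A)) :
    D.gaussBLAt A = ENNReal.ofReal ((D.opM A).det ^ (-(1 / 2) : ℝ)) /
      ∏ j, ENNReal.ofReal ((A j).det ^ (-(1 / 2) : ℝ)) ^ D.p j := by
  have h0 : ∀ j, 0 < (A j).det := fun j => (hA j).det_pos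
  have e : ∀ j, ENNReal.ofReal ((A j).det ^ (-(1 / 2) : ℝ)) ^ D.p j =
      ENNReal.ofReal (((A j).det ^ D.p j) ^ (-(1 / 2) : ℝ)) := by
    intro j
    rw [ENNReal.ofReal_rpow_of_nonneg (Real.rpow_nonneg (h0 j).le _) (D.p_nonneg j),
      ← Real.rpow_mul (h0 j).le, ← Real.rpow_mul (h0 j).le, mul_comm]
  have h1 : ∀ j, 0 < (A j).det ^ D.p j := fun j => Real.rpow_pos_of_pos (h0 j) _
  have hprod : 0 < ∏ j, (A j).det ^ D.p j := Finset.prod_pos fun j _ => h1 j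
  simp_rw [e]
  rw [← ENNReal.ofReal_prod_of_nonneg fun j _ => Real.rpow_nonneg (h1 j).le _,
    Real.finsetProd_rpow _ _ fun j _ => (h1 j).le,
    ← ENNReal.ofReal_div_of_pos (Real.rpow_pos_of_pos hprod _), gaussBLAt_eq_ofReal hA hM]
  congr 1
  rw [Real.div_rpow hprod.le hM.det_pos.le, Real.rpow_neg hprod.le, Real.rpow_neg hM.det_pos.le,
    div_inv_eq_mul, mul_comm, ← div_eq_mul_inv]

theorem gaussBLAt_lt_top (hA : IsGaussianInput A) (hM : IsPosDefOp (D.opM A)) :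
    D.gaussBLAt A < ∞ := by
  rw [gaussBLAt_eq_ofReal hA hM]
  exact ENNReal.ofReal_lt_top

theorem isUnit_opM_of_gaussBLAt_lt_top (hA : IsGaussianInput A) (h : D.gaussBLAt A < ∞) :
    IsUnit (D.opM A) := by
  refine ContinuousLinearMap.isUnit_of_det_ne_zero fun h0 => h.ne ?_
  rw [gaussBLAt, h0, ENNReal.ofReal_zero, ENNReal.div_zero, ENNReal.top_rpow_of_pos (by norm_num)]
  refine Finset.prod_ne_zero_iff.2 fun j _ => ?_
  exact (ENNReal.rpow_pos (ENNReal.ofReal_pos.2 (hA j).det_pos) ENNReal.ofReal_ne_top).ne'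

end Algebra

end BLDatum

/-! ### First variation of the gaussian functional. -/

namespace BLDatum

section FirstOrder

variable {m : ℕ} {H : Type*} [NormedAddCommGroup H] [InnerProductSpace ℝ H]
  [FiniteDimensional ℝ H] {K : Fin m → Type*}
  [∀ j, NormedAddCommGroup (K j)] [∀ j, InnerProductSpace ℝ (K j)]
  [∀ j, FiniteDimensional ℝ (K j)] {D : BLDatum H K} {A : ∀ j, K j →L[ℝ] K j}

theorem opM_update (D : BLDatum H K) (A : ∀ j, K j →L[ℝ] K j) (j : Fin m) (S : K j →L[ℝ] K j)
    (t : ℝ) : D.opM (Function.update A j (A j + t • S)) =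
      D.opM A + t • (D.p j • (ContinuousLinearMap.adjoint (D.B j) ∘L S ∘L D.B j)) := by
  set N := D.p j • (ContinuousLinearMap.adjoint (D.B j) ∘L S ∘L D.B j) with hN
  have h : ∀ i, D.p i • (ContinuousLinearMap.adjoint (D.B i) ∘L
      Function.update A j (A j + t • S) i ∘L D.B i) =
      D.p i • (ContinuousLinearMap.adjoint (D.B i) ∘L A i ∘L D.B i) +
        if i = j then t • N else 0 := by
    intro i
    rcases eq_or_ne i j with rfl | hij
    · rw [Function.update_self, if_pos rfl, hN]
      ext x
      simp [smul_smul, mul_comm t]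
    · simp [hij]
  simp only [opM, h, Finset.sum_add_distrib, Finset.sum_ite_eq', Finset.mem_univ, if_true]

theorem _root_.ContinuousLinearMap.det_add_smul_of_isUnit {E : Type*} [NormedAddCommGroup E]
    [InnerProductSpace ℝ E] {T : E →L[ℝ] E} (hT : IsUnit T)
    (S : E →L[ℝ] E) (t : ℝ) : (T + t • S).det = T.det * (1 + t • (Ring.inverse T * S)).det := by
  have h : T + t • S = T * (1 + t • (Ring.inverse T * S)) := by
    rw [mul_add, mul_one, mul_smul_comm, ← mul_assoc, Ring.mul_inverse_cancel T hT, one_mul]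
  have h2 : ((T + t • S : E →L[ℝ] E) : E →ₗ[ℝ] E) = (T : E →ₗ[ℝ] E) *
      ((1 + t • (Ring.inverse T * S) : E →L[ℝ] E) : E →ₗ[ℝ] E) := by
    rw [h]; rfl
  rw [ContinuousLinearMap.det, h2, map_mul]

theorem prod_det_update_rpow (hA : IsGaussianInput A) (q : Fin m → ℝ) (j : Fin m)
    (S : K j →L[ℝ] K j) (t : ℝ) (hpos : 0 ≤ (1 + t • (Ring.inverse (A j) * S)).det) :
    ∏ i, (Function.update A j (A j + t • S) i).det ^ q i =
      (∏ i, (A i).det ^ q i) * (1 + t • (Ring.inverse (A j) * S)).det ^ q j := by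
  have h : ∀ i, (Function.update A j (A j + t • S) i).det ^ q i = (A i).det ^ q i *
      if i = j then (1 + t • (Ring.inverse (A j) * S)).det ^ q j else 1 := by
    intro i
    rcases eq_or_ne i j with rfl | hij
    · rw [Function.update_self, if_pos rfl,
        ContinuousLinearMap.det_add_smul_of_isUnit (hA i).isUnit,
        Real.mul_rpow (hA i).det_pos.le hpos]
    · simp [hij]
  simp only [h, Finset.prod_mul_distrib, Finset.prod_ite_eq', Finset.mem_univ, if_true]

/-- The Euler--Lagrange equation at a local extremiser. -/
theorem IsLocalExtremiser.euler_lagrange (hp : ∀ j, 0 < D.p j) (h : D.IsLocalExtremiser A) :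
    IsUnit (D.opM A) ∧ ∀ j, Ring.inverse (A j) -
      D.B j ∘L Ring.inverse (D.opM A) ∘L ContinuousLinearMap.adjoint (D.B j) = 0 := by
  obtain ⟨hA, hfin, hloc⟩ := h
  have hMu := isUnit_opM_of_gaussBLAt_lt_top hA hfin
  have hker := ker_of_isUnit_opM hMu
  have hM := isPosDefOp_opM_of_ker hp hA hker
  refine ⟨hMu, fun j => ?_⟩
  obtain ⟨C, hC⟩ := hM.exists_isInvSqrt
  obtain ⟨Cj, hCj⟩ := (hA j).exists_isInvSqrt
  set R := D.B j ∘L Ring.inverse (D.opM A) ∘L ContinuousLinearMap.adjoint (D.B j) with hR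
  have hRs : IsSelfAdjoint R := by
    have := isSelfAdjoint_adjoint_comp_comp (ContinuousLinearMap.adjoint (D.B j))
      hC.isSelfAdjoint_inverse
    rwa [ContinuousLinearMap.adjoint_adjoint] at this
  -- The defect itself is the direction of perturbation, so that the first variation becomes the
  -- trace of a square.
  set S := Ring.inverse (A j) - R with hS
  have hSs : IsSelfAdjoint S := hCj.isSelfAdjoint_inverse.sub hRs
  refine hSs.eq_zero_of_trace_comp_self ?_
  set N := D.p j • (ContinuousLinearMap.adjoint (D.B j) ∘L S ∘L D.B j) with hN
  set X := Ring.inverse (A j) * S with hX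
  set Y := Ring.inverse (D.opM A) * N with hY
  have hpos : ∀ᶠ t : ℝ in 𝓝 0, IsGaussianInput (Function.update A j (A j + t • S)) := by
    filter_upwards [(hA j).eventually_add_smul hSs] with t ht i
    rcases eq_or_ne i j with rfl | hij
    · rwa [Function.update_self]
    · rw [Function.update_of_ne hij]; exact hA i
  have hcont : Tendsto (fun t : ℝ => Function.update A j (A j + t • S)) (𝓝 0)
      (𝓝[{A' | IsGaussianInput A'}] A) := by
    refine tendsto_nhdsWithin_iff.2 ⟨?_, hpos⟩
    have hc : Continuous fun t : ℝ => Function.update A j (A j + t • S) :=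
      continuous_const.update j (by fun_prop)
    simpa using hc.tendsto 0
  -- Dividing the maximality inequality by the value at `A` leaves only the two relative
  -- determinants. Their difference is nonnegative near `0` and vanishes at `0`.
  have hmin : IsLocalMin (fun t : ℝ => (1 + t • Y).det - (1 + t • X).det ^ D.p j) 0 := by
    filter_upwards [hcont.eventually hloc, hpos] with t hle hg
    have hMt := isPosDefOp_opM_of_ker hp hg hker
    have hdX : 0 < (1 + t • X).det := by
      have := (hg j).det_pos
      rw [Function.update_self, ContinuousLinearMap.det_add_smul_of_isUnit (hA j).isUnit] at this
      exact (mul_pos_iff_of_pos_left (hA j).det_pos).1 this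
    have hdY : 0 < (1 + t • Y).det := by
      have := hMt.det_pos
      rw [opM_update, ContinuousLinearMap.det_add_smul_of_isUnit hMu] at this
      exact (mul_pos_iff_of_pos_left hM.det_pos).1 this
    have hP : 0 < ∏ i, (A i).det ^ D.p i :=
      Finset.prod_pos fun i _ => Real.rpow_pos_of_pos (hA i).det_pos _
    rw [gaussBLAt_eq_ofReal hg hMt, gaussBLAt_eq_ofReal hA hM,
      ENNReal.ofReal_le_ofReal_iff (Real.rpow_nonneg (div_pos hP hM.det_pos).le _),
      prod_det_update_rpow hA _ _ _ _ hdX.le, opM_update,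
      ContinuousLinearMap.det_add_smul_of_isUnit hMu, mul_div_mul_comm,
      Real.rpow_le_rpow_iff (mul_pos (div_pos hP hM.det_pos)
        (div_pos (Real.rpow_pos_of_pos hdX _) hdY)).le (div_pos hP hM.det_pos).le (by norm_num),
      mul_le_iff_le_one_right (div_pos hP hM.det_pos), div_le_one hdY] at hle
    simp only [zero_smul, add_zero]
    have h1 : ((1 : H →L[ℝ] H)).det = 1 := LinearMap.det_id
    have h2 : ((1 : K j →L[ℝ] K j)).det = 1 := LinearMap.det_id
    rw [h1, h2, Real.one_rpow, sub_self]
    exact sub_nonneg.2 hle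
  have h2 : (1 + (0 : ℝ) • X).det = 1 := by
    rw [zero_smul, add_zero]; exact LinearMap.det_id
  have hder := (hasDerivAt_det_one_add_smul Y).sub
    ((hasDerivAt_det_one_add_smul X).rpow_const (p := D.p j) (.inl (by rw [h2]; exact one_ne_zero)))
  have hzero := hmin.hasDerivAt_eq_zero hder
  rw [h2, Real.one_rpow, mul_one] at hzero
  -- Cyclicity moves the trace from `H` to `K j`; the derivative at `0` is then `p_j (tr (R S) - tr
  -- (A_j⁻¹ S)) = -p_j tr (S²)`.
  have htY : LinearMap.trace ℝ H (Y : H →ₗ[ℝ] H) =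
      D.p j * LinearMap.trace ℝ (K j) ((R ∘L S : K j →L[ℝ] K j) : K j →ₗ[ℝ] K j) := by
    have e1 : (Y : H →ₗ[ℝ] H) = D.p j •
        (((Ring.inverse (D.opM A) ∘L ContinuousLinearMap.adjoint (D.B j) ∘L S : K j →L[ℝ] H) :
          K j →ₗ[ℝ] H) ∘ₗ (D.B j : H →ₗ[ℝ] K j)) := by
      rw [hY, hN, mul_smul_comm]; rfl
    rw [e1, map_smul, LinearMap.trace_comp_comm', smul_eq_mul]
    rfl
  have hSS : ((S ∘L S : K j →L[ℝ] K j) : K j →ₗ[ℝ] K j) =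
      (X : K j →ₗ[ℝ] K j) - ((R ∘L S : K j →L[ℝ] K j) : K j →ₗ[ℝ] K j) := by
    ext x
    rfl
  rw [hSS, map_sub]
  rw [htY, mul_comm _ (D.p j), ← mul_sub] at hzero
  have := (mul_eq_zero.1 hzero).resolve_left (hp j).ne'
  linarith

/-- Scaling is the trace identity of the conjugated geometric datum, and `y = A_j⁻¹ A_j y = B_j (M⁻¹
B_j* A_j y)` exhibits a preimage. -/
theorem scaling_nonDegenerate_of_euler_lagrange (hA : IsGaussianInput A)
    (hM : IsPosDefOp (D.opM A))
    (h : ∀ j, Ring.inverse (A j) -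
      D.B j ∘L Ring.inverse (D.opM A) ∘L ContinuousLinearMap.adjoint (D.B j) = 0) :
    D.Scaling ∧ D.NonDegenerate := by
  obtain ⟨C, hC⟩ := hM.exists_isInvSqrt
  choose Cj hCj using fun j => (hA j).exists_isInvSqrt
  refine ⟨((geometric_conj_iff hC hCj).2 h).scaling, fun j y => ?_, ker_of_isUnit_opM hC.1⟩
  have h1 := DFunLike.congr_fun (sub_eq_zero.1 (h j)) (A j y)
  rw [← mul_apply_eq_comp, Ring.inverse_mul_cancel _ (hA j).isUnit, one_apply_eq_self] at h1
  exact ⟨_, h1.symm⟩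

end FirstOrder

/-! ### Comparison of the Brascamp–Lieb constants. -/

section Constants

variable {m : ℕ} {H : Type*} [NormedAddCommGroup H] [InnerProductSpace ℝ H]
  [FiniteDimensional ℝ H] [MeasurableSpace H] [BorelSpace H] {K : Fin m → Type*}
  [∀ j, NormedAddCommGroup (K j)] [∀ j, InnerProductSpace ℝ (K j)]
  [∀ j, FiniteDimensional ℝ (K j)] [∀ j, MeasurableSpace (K j)] [∀ j, BorelSpace (K j)]
  {D : BLDatum H K} {A : ∀ j, K j →L[ℝ] K j}

theorem gaussBLAt_le_bl (hA : IsGaussianInput A) (hM : IsPosDefOp (D.opM A)) :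
    D.gaussBLAt A ≤ D.bl := by
  -- With the factor `π` in the exponent the gaussian integrals are pure powers of determinants.
  set f : ∀ j, K j → ℝ≥0 := fun j y =>
    (Real.exp (-Real.pi * inner ℝ (A j y) y)).toNNReal with hf
  have hfint : ∀ j, ∫⁻ y, (f j y : ℝ≥0∞) = ENNReal.ofReal ((A j).det ^ (-(1 / 2) : ℝ)) :=
    fun j => (hA j).lintegral_gaussian
  have hin : IsInput f := by
    intro j
    refine ⟨Measurable.real_toNNReal (Continuous.measurable (by fun_prop)), ?_, ?_⟩
    · rw [hfint]
      exact ENNReal.ofReal_pos.2 (Real.rpow_pos_of_pos (hA j).det_pos _)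
    · rw [hfint]
      exact ENNReal.ofReal_lt_top
  have hnum : ∫⁻ x : H, ∏ j, (f j (D.B j x) : ℝ≥0∞) ^ D.p j =
      ENNReal.ofReal ((D.opM A).det ^ (-(1 / 2) : ℝ)) := by
    rw [← hM.lintegral_gaussian]
    refine lintegral_congr fun x => ?_
    have e : ∀ j, (f j (D.B j x) : ℝ≥0∞) ^ D.p j =
        ENNReal.ofReal (Real.exp (-Real.pi * (D.p j * inner ℝ (A j (D.B j x)) (D.B j x)))) := by
      intro j
      refine (ENNReal.ofReal_rpow_of_nonneg (Real.exp_pos _).le (D.p_nonneg j)).trans ?_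
      rw [← Real.exp_mul]
      congr 2
      ring
    simp_rw [e]
    rw [← ENNReal.ofReal_prod_of_nonneg fun j _ => (Real.exp_pos _).le, ← Real.exp_sum,
      ← Finset.mul_sum, inner_opM]
  have : D.gaussBLAt A = D.blAt f := by
    rw [gaussBLAt_eq_div hA hM, blAt, hnum]
    simp_rw [hfint]
  rw [this]
  exact le_iSup₂_of_le f hin le_rfl

/-- Substituting `C` on `H` and `Cj` on `K j` reduces to the geometric inequality; the Jacobians
assemble to the gaussian constant at `A`. -/
theorem bl_le_gaussBLAt (hA : IsGaussianInput A) (hM : IsPosDefOp (D.opM A))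
    (h : ∀ j, Ring.inverse (A j) -
      D.B j ∘L Ring.inverse (D.opM A) ∘L ContinuousLinearMap.adjoint (D.B j) = 0) :
    D.bl ≤ D.gaussBLAt A := by
  obtain ⟨C, hC⟩ := hM.exists_isInvSqrt
  choose Cj hCj using fun j => (hA j).exists_isInvSqrt
  have hgeo := (geometric_conj_iff hC hCj).2 h
  refine iSup₂_le fun f hf => ?_
  set d : Fin m → ℝ≥0∞ := fun j => ENNReal.ofReal ((A j).det ^ (-(1 / 2) : ℝ)) with hd
  set I : Fin m → ℝ≥0∞ := fun j => ∫⁻ y, (f j (Cj j y) : ℝ≥0∞) with hI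
  have hd0 : ∀ j, d j ≠ 0 := fun j =>
    (ENNReal.ofReal_pos.2 (Real.rpow_pos_of_pos (hA j).det_pos _)).ne'
  have hdt : ∀ j, d j ≠ ∞ := fun j => ENNReal.ofReal_ne_top
  have hfI : ∀ j, ∫⁻ y, (f j y : ℝ≥0∞) = d j * I j := by
    intro j
    rw [lintegral_eq_det_mul_lintegral_comp (Cj j), (hCj j).abs_det]
  have hI0 : ∀ j, I j ≠ 0 := fun j h0 => by
    have := (hf j).2.1
    rw [hfI, h0, mul_zero] at this
    exact lt_irrefl _ this
  have hIt : ∀ j, I j < ∞ := fun j => by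
    have := (hf j).2.2
    rw [hfI] at this
    exact (ENNReal.mul_lt_top_iff.1 this).elim (fun h => h.2)
      fun h => h.elim (fun h => absurd h (hd0 j)) fun h => h ▸ ENNReal.zero_lt_top
  have key := hgeo.lintegral_prod_le (f := fun j y => f j (Cj j y))
    (fun j => (hf j).1.comp (Cj j).continuous.measurable) hIt
  have e1 : ∀ j x, Cj j ((D.conj C Cj).B j x) = D.B j (C x) := fun j x =>
    (Cj j).apply_symm_apply _
  simp only [e1] at key
  rw [blAt, lintegral_eq_det_mul_lintegral_comp C, hC.abs_det, gaussBLAt_eq_div hA hM]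
  simp_rw [hfI, ENNReal.mul_rpow_of_nonneg _ _ (D.p_nonneg _)]
  rw [Finset.prod_mul_distrib]
  have hPI0 : ∏ j, I j ^ D.p j ≠ 0 := Finset.prod_ne_zero_iff.2 fun j _ =>
    (ENNReal.rpow_pos (pos_iff_ne_zero.2 (hI0 j)) (hIt j).ne).ne'
  have hPIt : ∏ j, I j ^ D.p j ≠ ∞ := ENNReal.prod_ne_top fun j _ =>
    ENNReal.rpow_ne_top_of_nonneg (D.p_nonneg j) (hIt j).ne
  refine (ENNReal.div_le_div_right (mul_le_mul_right key _) _).trans_eq ?_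
  exact ENNReal.mul_div_mul_right _ _ hPI0 hPIt

/-- The chain `BL ≤ BL_g(A) ≤ BL_g ≤ BL` closes up. Invertibility of `M` at the single input `A`
gives the trivial common kernel needed at every other input. -/
theorem bl_eq_gaussBL_eq_gaussBLAt (hp : ∀ j, 0 < D.p j) (hA : IsGaussianInput A)
    (hMu : IsUnit (D.opM A))
    (h : ∀ j, Ring.inverse (A j) -
      D.B j ∘L Ring.inverse (D.opM A) ∘L ContinuousLinearMap.adjoint (D.B j) = 0) :
    D.bl = D.gaussBLAt A ∧ D.gaussBL = D.gaussBLAt A := by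
  have hker := ker_of_isUnit_opM hMu
  have hle := bl_le_gaussBLAt hA (isPosDefOp_opM_of_ker hp hA hker) h
  have h1 : D.gaussBLAt A ≤ D.gaussBL := le_iSup₂_of_le A hA le_rfl
  have h2 : D.gaussBL ≤ D.bl := iSup₂_le fun A' hA' =>
    gaussBLAt_le_bl hA' (isPosDefOp_opM_of_ker hp hA' hker)
  exact ⟨hle.antisymm (h1.trans h2), (h2.trans hle).antisymm h1⟩

theorem Geometric.bl_eq_one {D : BLDatum H K} (hp : ∀ j, 0 < D.p j) (hD : D.Geometric) :
    D.bl = 1 ∧ D.gaussBL = 1 := by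
  set A₁ : ∀ j, K j →L[ℝ] K j := fun j => 1 with hA₁
  have hA : IsGaussianInput A₁ := fun j =>
    ⟨IsSelfAdjoint.one _, fun x hx => by
      rw [hA₁, one_apply_eq_self, real_inner_self_eq_norm_sq]
      exact pow_pos (norm_pos_iff.2 hx) 2⟩
  have hM : D.opM A₁ = 1 := hD.2
  have h := bl_eq_gaussBL_eq_gaussBLAt hp hA (by rw [hM]; exact isUnit_one) fun j => by
    rw [hM, hA₁, Ring.inverse_one, Ring.inverse_one, sub_eq_zero]
    exact (hD.1 j).symm
  have h1 : D.gaussBLAt A₁ = 1 := by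
    have e1 : ∀ j, (A₁ j).det = 1 := fun j => LinearMap.det_id
    have e2 : (1 : H →L[ℝ] H).det = 1 := LinearMap.det_id
    simp only [gaussBLAt, hM, e1, e2]
    simp
  rwa [h1] at h

end Constants

end BLDatum

/-! ### The equivalences, with (c) as the hub. -/

theorem mainTheorem9 {m : ℕ} {H : Type*} [NormedAddCommGroup H] [InnerProductSpace ℝ H]
    [FiniteDimensional ℝ H] [MeasurableSpace H] [BorelSpace H]
    {K : Fin m → Type*} [∀ j, NormedAddCommGroup (K j)] [∀ j, InnerProductSpace ℝ (K j)]
    [∀ j, FiniteDimensional ℝ (K j)] [∀ j, MeasurableSpace (K j)] [∀ j, BorelSpace (K j)]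
    (D : BLDatum H K) (hp : ∀ j, 0 < D.p j)
    (A : ∀ j, K j →L[ℝ] K j) (hA : BLDatum.IsGaussianInput A) :
    List.TFAE [
      D.IsGlobalExtremiser A,
      D.IsLocalExtremiser A,
      IsUnit (D.opM A) ∧ ∀ j, Ring.inverse (A j) -
        D.B j ∘L Ring.inverse (D.opM A) ∘L ContinuousLinearMap.adjoint (D.B j) = 0,
      D.Scaling ∧ D.NonDegenerate ∧ ∀ j,
        D.B j ∘L Ring.inverse (D.opM A) ∘L ContinuousLinearMap.adjoint (D.B j)
          ≤ Ring.inverse (A j),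
      D.Scaling ∧ D.NonDegenerate ∧ ∀ j,
        ContinuousLinearMap.adjoint (D.B j) ∘L A j ∘L D.B j ≤ D.opM A,
      ∃ (D' : BLDatum H K) (C : H ≃L[ℝ] H) (Cj : ∀ j, K j ≃L[ℝ] K j),
        IsInvSqrt (C : H →L[ℝ] H) (D.opM A) ∧
        (∀ j, IsInvSqrt (Cj j : K j →L[ℝ] K j) (A j)) ∧
        D.EquivalentVia D' C Cj ∧ D'.Geometric ∧
        D.bl = D'.bl * D.gaussBLAt A ∧
        D.gaussBL = D'.gaussBL * D.gaussBLAt A,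
      ∃ (D' : BLDatum H K) (C : H ≃L[ℝ] H) (Cj : ∀ j, K j ≃L[ℝ] K j),
        IsInvSqrt (C : H →L[ℝ] H) (D.opM A) ∧
        (∀ j, IsInvSqrt (Cj j : K j →L[ℝ] K j) (A j)) ∧
        D.EquivalentVia D' C Cj ∧ D'.Geometric ∧
        (∀ j, Set.range (Cj j) = Set.univ) ∧
        D.bl = D.gaussBL ∧ D.gaussBL = D.gaussBLAt A] ∧
    (D.IsGlobalExtremiser A →
      D.gaussBL = D.gaussBLAt A ∧ D.gaussBL < ∞ ∧ D.GaussianExtremisable) := by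
  choose Cj hCj using fun j => (hA j).exists_isInvSqrt
  have hinv : ∀ hk : ∀ x : H, (∀ j, D.B j x = 0) → x = 0,
      ∃ C : H ≃L[ℝ] H, IsInvSqrt (C : H →L[ℝ] H) (D.opM A) := fun hk =>
    (BLDatum.isPosDefOp_opM_of_ker hp hA hk).exists_isInvSqrt
  refine ⟨?_, fun h => ?_⟩
  · tfae_have 1 → 2 := fun h => ⟨h.1, h.2.1, Filter.eventually_of_mem self_mem_nhdsWithin h.2.2⟩
    tfae_have 2 → 3 := fun h => h.euler_lagrange hp
    tfae_have 3 → 1 := fun h => by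
      have hpd := BLDatum.isPosDefOp_opM_of_ker hp hA (BLDatum.ker_of_isUnit_opM h.1)
      refine ⟨hA, BLDatum.gaussBLAt_lt_top hA hpd, fun A' hA' => ?_⟩
      rw [← (BLDatum.bl_eq_gaussBL_eq_gaussBLAt hp hA h.1 h.2).2]
      exact le_iSup₂_of_le A' hA' le_rfl
    tfae_have 3 → 4 := fun h => by
      have hpd := BLDatum.isPosDefOp_opM_of_ker hp hA (BLDatum.ker_of_isUnit_opM h.1)
      obtain ⟨hs, hn⟩ := BLDatum.scaling_nonDegenerate_of_euler_lagrange hA hpd h.2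
      exact ⟨hs, hn, fun j => (sub_eq_zero.1 (h.2 j)).ge⟩
    tfae_have 4 → 3 := fun ⟨hs, hn, hle⟩ => by
      obtain ⟨C, hC⟩ := hinv hn.2
      refine ⟨hC.1, fun j => (BLDatum.conj_comp_adjoint_eq_id_iff hC hCj j).1 ?_⟩
      exact BLDatum.comp_adjoint_eq_id_of_norm_le (D := D.conj C Cj) hp hs
        (BLDatum.sum_conj_eq_id hC hCj)
        (fun j => (BLDatum.comp_inverse_comp_adjoint_le_iff hC hCj j).1 (hle j)) j
    -- In conjugated form the two inequalities say `‖B'_j*‖ ≤ 1` and `‖B'_j‖ ≤ 1`.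
    tfae_have 4 ↔ 5 := by
      refine and_congr_right fun _ => and_congr_right fun hn => forall_congr' fun j => ?_
      obtain ⟨C, hC⟩ := hinv hn.2
      rw [BLDatum.comp_inverse_comp_adjoint_le_iff hC hCj,
        BLDatum.adjoint_comp_comp_le_opM_iff hA hC hCj, BLDatum.norm_adjoint_apply_le_iff]
    tfae_have 3 → 6 := fun h => by
      obtain ⟨C, hC⟩ := hinv (BLDatum.ker_of_isUnit_opM h.1)
      have hgeo := (BLDatum.geometric_conj_iff hC hCj).2 h.2
      obtain ⟨h1, h2⟩ := BLDatum.Geometric.bl_eq_one (D := D.conj C Cj) hp hgeo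
      obtain ⟨h3, h4⟩ := BLDatum.bl_eq_gaussBL_eq_gaussBLAt hp hA h.1 h.2
      exact ⟨D.conj C Cj, C, Cj, hC, hCj, D.equivalentVia_conj C Cj, hgeo,
        by rw [h1, one_mul, h3], by rw [h2, one_mul, h4]⟩
    tfae_have 3 → 7 := fun h => by
      obtain ⟨C, hC⟩ := hinv (BLDatum.ker_of_isUnit_opM h.1)
      have hgeo := (BLDatum.geometric_conj_iff hC hCj).2 h.2
      obtain ⟨h3, h4⟩ := BLDatum.bl_eq_gaussBL_eq_gaussBLAt hp hA h.1 h.2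
      exact ⟨D.conj C Cj, C, Cj, hC, hCj, D.equivalentVia_conj C Cj, hgeo,
        fun j => (Cj j).surjective.range_eq, by rw [h3, h4], h4⟩
    -- The intertwining maps determine `D'`, and its geometricity alone gives (c); the identities
    -- between constants play no role in this direction.
    tfae_have 6 → 3 := fun ⟨D', C, Cj', hC, hCj', he, hgeo, _⟩ => by
      rw [he.eq_conj] at hgeo
      exact ⟨hC.1, (BLDatum.geometric_conj_iff hC hCj').1 hgeo⟩
    tfae_have 7 → 3 := fun ⟨D', C, Cj', hC, hCj', he, hgeo, _⟩ => by
      rw [he.eq_conj] at hgeo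
      exact ⟨hC.1, (BLDatum.geometric_conj_iff hC hCj').1 hgeo⟩
    tfae_finish
  · have heq : D.gaussBL = D.gaussBLAt A :=
      (iSup₂_le h.2.2).antisymm (le_iSup₂_of_le A hA le_rfl)
    exact ⟨heq, heq ▸ h.2.1, heq ▸ h.2.1, A, hA, heq⟩
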